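/- The localization game with $k\ge 1$ sensors on a finite graph $G$ is played in rounds $t=1,2,\dots$. In round $t$ the cops choose a set $S_t\subseteq V(G)$ with $|S_t|=k$ (depending on the information received so far); an invisible robber then chooses a vertex $v_t$, arbitrary for $t=1$ and equal or adjacent to $v_{t-1}$ for $t\ge 2$; and the cops learn the distance from $v_t$ to each vertex of $S_t$. The cops win in round $t$ if all robber walks consistent with the information received up to and including round $t$ end at the same vertex. The localization number $\zeta(G)$ is the least $k$ for which the cops have a strategy that wins in finite time whatever the robber does. Let $\mathcal G(n,p)$ be the binomial random graph on $n$ vertices, in which each pair of vertices is an edge independently with probability $p=p(n)$. Theorem. Let $d=d(n):=p(n)\cdot n$ be such that $\log n\ll d\ll n$, where $f\ll g$ means $f(n)/g(n)\to 0$ as $n\to\infty$. Let $i=i(n)\in\mathbb N$ be the largest integer such that $d^i\ll n\log\log n$; that is, $d^{i}\ll n\log\log n$, and every $j=j(n)\in\mathbb N$ with $d^{j}\ll n\log\log n$ satisfies $j(n)\le i(n)$ for all large $n$. Suppose that $d^{i+1}/n-2\log n\to\infty$. Then $$\Pr\left[\zeta(\mathcal G(n,p))\ge\left(\log d-3\log\log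 n\right)\frac{n}{d^i}\right]\longrightarrow 1\qquad\text{as } n\to\infty .$$ -/

import Mathlib

open Filter Topology Asymptotics

/-- The information that the cops receive when their sensors stand on the vertices of `S` and the
robber stands on `v`: the distance from `s` to `v` for each sensor `s ∈ S`, and nothing (`none`)
for a vertex that carries no sensor.  It records the sensor locations and the `S`-signature of `v`.
Distances are taken in `ℕ∞`; in a connected graph they are the usual natural numbers. -/
noncomputable def signature {V : Type*} (G : SimpleGraph V) (S : Finset V) (v : V) :
    V → Option ℕ∞ :=
  open Classical in fun s => if s ∈ S then some (G.edist s v) else none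

/-- A (deterministic) strategy of the cops with `k` sensors: given the information received in all
the previous rounds, it names the set of the `k` sensor locations for the next round. -/
structure CopStrategy (V : Type*) (k : ℕ) where
  sensors : List (V → Option ℕ∞) → Finset V
  card_sensors : ∀ h, (sensors h).card = k

/-- The info trail after `t` rounds when the cops follow the strategy `σ` and the robber is on the
vertex `w j` in round `j` (rounds are numbered from `0`). -/
noncomputable def infoTrail {V : Type*} (G : SimpleGraph V) {k : ℕ} (σ : CopStrategy V k)
    (w : ℕ → V) : ℕ → List (V → Option ℕ∞)
  | 0 => []
  | t + 1 => infoTrail G σ w t ++ [signature G (σ.sensors (infoTrail G σ w t)) (w t)]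

/-- A legal trajectory of the robber: in every step she stays where she is or moves along an
edge. -/
def IsRobberWalk {V : Type*} (G : SimpleGraph V) (w : ℕ → V) : Prop :=
  ∀ t, w (t + 1) = w t ∨ G.Adj (w t) (w (t + 1))

/-- The robber who walks along `w` against the strategy `σ` is located in round `t`: all robber
walks with the same info trail up to and including that round are on the same vertex in round `t`.
-/
def LocatedAt {V : Type*} (G : SimpleGraph V) {k : ℕ} (σ : CopStrategy V k) (w : ℕ → V) (t : ℕ) :
    Prop :=
  ∀ x : ℕ → V, IsRobberWalk G x → infoTrail G σ x (t + 1) = infoTrail G σ w (t + 1) → x t = w t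

/-- The cops can win the localization game on `G` with `k` sensors: some strategy of the cops
locates the robber in finite time, whatever the robber does. -/
def CopsWin {V : Type*} (G : SimpleGraph V) (k : ℕ) : Prop :=
  ∃ σ : CopStrategy V k, ∀ w : ℕ → V, IsRobberWalk G w → ∃ t, LocatedAt G σ w t

/-- The localization number `ζ(G)`: the least integer `k ≥ 1` such that the cops can win with `k`
sensors (on a finite nonempty graph, sensors on all the vertices locate the robber at once). -/
noncomputable def localizationNumber {V : Type*} (G : SimpleGraph V) : ℕ :=
  sInf {k | 1 ≤ k ∧ CopsWin G k}

/-! The robber is safe if, whatever the sensors, any `a ≥ 2` candidate positions can be replaced by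
`a` new ones, each equal or adjacent to an old one, that all have the same signature
(`not_copsWin_of_forall_exists`). So it suffices to find graph properties that permit this and hold
with high probability. Write L = log n, i = j + 1 and C = log d - 3 log L, so that e^(-C) = L³/d.
One may assume C > 0, since otherwise the bound is not positive.

Suppose pL ≤ 16. The robber keeps 2m candidates, where m is about (C + 25) n/d. Fewer than C n/d^i
sensors have at most m vertices within distance j, so some m candidates A avoid a set B of m
vertices that contains these balls. A vertex outside A ∪ B has a neighbour in A and none in B with
probability of order at least L³/d. Hence there are at least of order L³ n/d such vertices, and the
failure probability exp(-const · L³ n/d) beats the exp(O(L² n/d)) choices of (A, B); this is where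
the 3 log log n comes from (`measureReal_exists_disjoint_le`). All these vertices are at distance at
least j + 2 from every sensor. The assumption on d^(i+1)/n implies that fewer than m pairs of
vertices are at distance more than j + 2 (`measureReal_le_card_far_le`). So 2m of the vertices found
are at distance exactly j + 2 from all sensors, and they are the new candidates
(`not_copsWin_of_expansion`).

Suppose pL > 16. Then i = 1 and the diameter is at most two, so a sensor only tells whether it is
adjacent to the robber. Two candidates suffice: among the at least d/2 neighbours of one candidate
that carry no sensor, two have the same adjacencies to the sensors (`not_copsWin_of_twins`). By a
birthday estimate this fails for given sensors with probability about exp(-L³/8)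
(`measureReal_injOn_le`), which beats the exp((K + 1)L) choices, as the number K of sensors is at
most L²/16. -/

open MeasureTheory ProbabilityTheory

/-! ### Independence of edge events in the binomial random graph -/

namespace SimpleGraph

variable {V : Type*}

/-- The event `A` depends only on which elements of `E` are edges. -/
def DeterminedBy (A : Set (SimpleGraph V)) (E : Set (Sym2 V)) : Prop :=
  ∀ ⦃G H : SimpleGraph V⦄, (∀ e ∈ E, e ∈ G.edgeSet ↔ e ∈ H.edgeSet) → G ∈ A → H ∈ A

theorem DeterminedBy.mono {A : Set (SimpleGraph V)} {E F : Set (Sym2 V)} (h : DeterminedBy A E)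
    (hEF : E ⊆ F) : DeterminedBy A F :=
  fun _ _ hGH hG => h (fun e he => hGH e (hEF he)) hG

theorem DeterminedBy.inter {A B : Set (SimpleGraph V)} {E : Set (Sym2 V)}
    (hA : DeterminedBy A E) (hB : DeterminedBy B E) : DeterminedBy (A ∩ B) E :=
  fun _ _ hGH hG => ⟨hA hGH hG.1, hB hGH hG.2⟩

theorem DeterminedBy.compl {A : Set (SimpleGraph V)} {E : Set (Sym2 V)}
    (hA : DeterminedBy A E) : DeterminedBy Aᶜ E :=
  fun _ _ hGH hG hH => hG (hA (fun e he => (hGH e he).symm) hH)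

theorem DeterminedBy.biInter {ι : Type*} {A : ι → Set (SimpleGraph V)} {E : ι → Set (Sym2 V)}
    (s : Finset ι) (hA : ∀ v ∈ s, DeterminedBy (A v) (E v)) :
    DeterminedBy (⋂ v ∈ s, A v) (⋃ v ∈ s, E v) := by
  intro G H hGH hG
  simp only [Set.mem_iInter] at hG ⊢
  intro v hv
  exact hA v hv (fun e he => hGH e (by simp only [Set.mem_iUnion]; exact ⟨v, hv, he⟩)) (hG v hv)

/-- Edges between `v` and `X`. -/
def pairsTo (v : V) (X : Finset V) : Set (Sym2 V) := {e | ∃ x ∈ X, e = s(v, x)}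

theorem pairwiseDisjoint_pairsTo {X W : Finset V} (h : Disjoint X W) :
    (W : Set V).PairwiseDisjoint (fun v => pairsTo v X) := by
  intro v hv w hw hvw
  rw [Function.onFun, Set.disjoint_left]
  rintro e ⟨x, hx, rfl⟩ ⟨y, hy, hxy⟩
  rw [Sym2.eq_iff] at hxy
  rcases hxy with ⟨h1, -⟩ | ⟨h1, -⟩
  · exact hvw h1
  · exact Finset.disjoint_left.1 h hy (h1 ▸ hv)

theorem determinedBy_not_adj (v : V) (X : Finset V) :
    DeterminedBy {G : SimpleGraph V | ∀ x ∈ X, ¬ G.Adj v x} (pairsTo v X) := by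
  intro G H hGH hG x hx
  have := hGH s(v, x) ⟨x, hx, rfl⟩
  simp only [mem_edgeSet] at this
  rw [← this]
  exact hG x hx

theorem determinedBy_adj (v x : V) : DeterminedBy {G : SimpleGraph V | G.Adj v x} {s(v, x)} := by
  intro G H hGH hG
  exact (hGH s(v, x) rfl).1 hG

variable [Fintype V]

instance discreteMeasurableSpace_of_fintype : DiscreteMeasurableSpace (SimpleGraph V) := by
  have : MeasurableSingletonClass (SimpleGraph V) := by
    refine ⟨fun G => ?_⟩
    have h : ({G} : Set (SimpleGraph V)) = edgeSet ⁻¹' {G.edgeSet} := by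
      ext H; simp
    rw [h]
    exact measurable_edgeSet (measurableSet_singleton _)
  have : Finite (SimpleGraph V) := Finite.of_injective _ (edgeSet_injective (V := V))
  infer_instance

/-- The random graph is the image of a product measure on `Sym2 V → Prop`, and each indicator is a
function of its own coordinate. Diagonal pairs are harmless, their indicators being constantly
false. -/
theorem iIndepFun_mem_edgeSet (p : unitInterval) :
    iIndepFun (fun (e : Sym2 V) (G : SimpleGraph V) => e ∈ G.edgeSet) (binomialRandom V p) := by
  classical
  set P : Sym2 V → Measure Prop := fun e =>
    unitInterval.toNNReal p • Measure.dirac (e ∈ (Sym2.diagSetᶜ : Set (Sym2 V))) +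
      unitInterval.toNNReal (unitInterval.symm p) • Measure.dirac False with hP
  have hmap : binomialRandom V p =
      (Measure.infinitePi P).map (fun ω => fromEdgeSet {e | ω e}) := by
    rw [binomialRandom_eq_map, setBernoulli_eq_map, Measure.map_map]
    · rfl
    · exact measurable_fromEdgeSet
    · fun_prop
  have hmeas : Measurable (fun ω : Sym2 V → Prop => fromEdgeSet {e | ω e}) :=
    measurable_fromEdgeSet.comp (by fun_prop)
  have h := iIndepFun_infinitePi (P := P) (X := fun e (t : Prop) => t ∧ ¬ e.IsDiag)
    (fun e => measurable_from_top)
  rw [iIndepFun_iff_measure_inter_preimage_eq_mul] at h ⊢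
  intro S sets hS
  rw [hmap, Measure.map_apply hmeas (MeasurableSet.of_discrete)]
  have := h S (sets := sets) hS
  have e1 : ∀ e : Sym2 V, (Measure.infinitePi P).map (fun ω => fromEdgeSet {e | ω e})
      ((fun G : SimpleGraph V => e ∈ G.edgeSet) ⁻¹' sets e) = (Measure.infinitePi P)
        ((fun ω : Sym2 V → Prop => ω e ∧ ¬ e.IsDiag) ⁻¹' sets e) := by
    intro e
    rw [Measure.map_apply hmeas (MeasurableSet.of_discrete)]
    congr 1
    ext ω
    simp
  simp_rw [e1, ← this]
  congr 1
  ext ω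
  simp

theorem measureReal_mem_edgeSet (p : unitInterval) {e : Sym2 V} (he : ¬ e.IsDiag) :
    (binomialRandom V p).real {G | e ∈ G.edgeSet} = p := by
  classical
  rw [measureReal_def, binomialRandom_eq_map, setBernoulli_eq_map, Measure.map_map
    measurable_fromEdgeSet (by fun_prop), Measure.map_apply
    (measurable_fromEdgeSet.comp (by fun_prop)) (MeasurableSet.of_discrete)]
  have h : ((fromEdgeSet : Set (Sym2 V) → SimpleGraph V) ∘ fun (p : Sym2 V → Prop) => {i | p i}) ⁻¹'
      {G | e ∈ G.edgeSet} = (fun ω => ω e) ⁻¹' {True} := by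
    ext ω
    simp [he]
  rw [h, ← Measure.map_apply (by fun_prop) (measurableSet_singleton _), Measure.infinitePi_map_eval]
  simp [he]

/-- An event determined by `E` is the full preimage of its image under restriction to `E`, so
independence of the two restrictions gives the product formula. -/
theorem DeterminedBy.measureReal_inter {A B : Set (SimpleGraph V)} {E F : Set (Sym2 V)}
    (hA : DeterminedBy A E) (hB : DeterminedBy B F) (hEF : Disjoint E F) (p : unitInterval) :
    (binomialRandom V p).real (A ∩ B) =
      (binomialRandom V p).real A * (binomialRandom V p).real B := by
  classical
  have hind := (iIndepFun_mem_edgeSet (V := V) p).indepFun_finset E.toFinset F.toFinset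
    (by simpa using hEF) (fun e => Measurable.of_discrete)
  have key : ∀ {C : Set (SimpleGraph V)} {K : Set (Sym2 V)}, DeterminedBy C K →
      (fun (G : SimpleGraph V) (e : K.toFinset) => (e : Sym2 V) ∈ G.edgeSet) ⁻¹'
        ((fun (G : SimpleGraph V) (e : K.toFinset) => (e : Sym2 V) ∈ G.edgeSet) '' C) = C := by
    intro C K hC
    refine Set.Subset.antisymm ?_ (Set.subset_preimage_image _ _)
    rintro H ⟨G, hG, hGH⟩
    refine hC (fun e he => ?_) hG
    exact iff_of_eq (congrFun hGH ⟨e, by simpa using he⟩)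
  have := hind.measure_inter_preimage_eq_mul
    ((fun (G : SimpleGraph V) (e : E.toFinset) => (e : Sym2 V) ∈ G.edgeSet) '' A)
    ((fun (G : SimpleGraph V) (e : F.toFinset) => (e : Sym2 V) ∈ G.edgeSet) '' B)
  rw [key hA, key hB] at this
  simp only [measureReal_def, this MeasurableSet.of_discrete MeasurableSet.of_discrete,
    ENNReal.toReal_mul]

theorem measureReal_biInter_of_determinedBy {ι : Type*} {A : ι → Set (SimpleGraph V)}
    {E : ι → Set (Sym2 V)} (s : Finset ι) (hA : ∀ v ∈ s, DeterminedBy (A v) (E v))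
    (hE : (s : Set ι).PairwiseDisjoint E) (p : unitInterval) :
    (binomialRandom V p).real (⋂ v ∈ s, A v) = ∏ v ∈ s, (binomialRandom V p).real (A v) := by
  classical
  induction s using Finset.induction_on with
  | empty => simp
  | insert a s ha ih =>
    rw [Finset.prod_insert ha, ← ih (fun v hv => hA v (Finset.mem_insert_of_mem hv))
      (hE.subset (by simp)), Finset.set_biInter_insert]
    refine (hA a (Finset.mem_insert_self _ _)).measureReal_inter
      (DeterminedBy.biInter s fun v hv => hA v (Finset.mem_insert_of_mem hv)) ?_ p
    rw [Set.disjoint_iUnion₂_right]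
    intro v hv
    exact hE (by simp) (by simp [hv]) (by rintro rfl; exact ha hv)

theorem measureReal_adj (p : unitInterval) {v x : V} (h : v ≠ x) :
    (binomialRandom V p).real {G : SimpleGraph V | G.Adj v x} = p :=
  measureReal_mem_edgeSet p (e := s(v, x)) (by simpa using h)

theorem measureReal_compl_adj (p : unitInterval) {v x : V} (h : v ≠ x) :
    (binomialRandom V p).real {G : SimpleGraph V | G.Adj v x}ᶜ = 1 - p := by
  rw [probReal_compl_eq_one_sub (MeasurableSet.of_discrete), measureReal_adj p h]

/-- The probability that `T` is exactly the set of neighbours of `v` within `X`. -/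
theorem measureReal_adj_iff_mem (p : unitInterval) {v : V} {X T : Finset V} (hv : v ∉ X)
    (hT : T ⊆ X) :
    (binomialRandom V p).real {G : SimpleGraph V | ∀ x ∈ X, G.Adj v x ↔ x ∈ T} =
      (p : ℝ) ^ T.card * (1 - p : ℝ) ^ (X.card - T.card) := by
  classical
  have h1 : {G : SimpleGraph V | ∀ x ∈ X, G.Adj v x ↔ x ∈ T} =
      ⋂ x ∈ X, (if x ∈ T then {G : SimpleGraph V | G.Adj v x} else {G | G.Adj v x}ᶜ) := by
    ext G
    simp only [Set.mem_ofPred_eq, Set.mem_iInter]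
    refine forall₂_congr fun x hx => ?_
    by_cases h : x ∈ T <;> simp [h]
  rw [h1, measureReal_biInter_of_determinedBy X (E := fun x => {s(v, x)})]
  · have h2 : ∀ x ∈ X, (binomialRandom V p).real
        (if x ∈ T then {G : SimpleGraph V | G.Adj v x} else {G | G.Adj v x}ᶜ) =
        if x ∈ T then (p : ℝ) else 1 - p := by
      intro x hx
      have hne : v ≠ x := by rintro rfl; exact hv hx
      split_ifs
      · exact measureReal_adj p hne
      · exact measureReal_compl_adj p hne
    rw [Finset.prod_congr rfl h2, Finset.prod_ite, Finset.prod_const, Finset.prod_const]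
    have h3 : X.filter (· ∈ T) = T := by
      ext x; simp only [Finset.mem_filter]; exact ⟨fun h => h.2, fun h => ⟨hT h, h⟩⟩
    have h4 : X.filter (· ∉ T) = X \ T := by
      ext x; simp
    rw [h3, h4, Finset.card_sdiff_of_subset hT]
  · intro x _
    split_ifs
    · exact determinedBy_adj v x
    · exact (determinedBy_adj v x).compl
  · intro x hx y hy hxy
    simp only [Function.onFun, Set.disjoint_singleton, ne_eq, Sym2.eq_iff]
    rintro (⟨-, h⟩ | ⟨h, h'⟩)
    · exact hxy h
    · exact hxy (h'.trans h)

theorem measureReal_not_adj (p : unitInterval) {v : V} {X : Finset V} (hv : v ∉ X) :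
    (binomialRandom V p).real {G : SimpleGraph V | ∀ x ∈ X, ¬ G.Adj v x} =
      (1 - p : ℝ) ^ X.card := by
  simpa using measureReal_adj_iff_mem p hv (Finset.empty_subset X)

/-- If `F` depends only on the pairs in `E` and, for each value `y` of `F`, the event `H y` depends
only on pairs outside `E` and has probability at most `c`, then so has `H (F G)`. -/
theorem measureReal_exists_le {β : Type*} [Finite β] (F : SimpleGraph V → β)
    (H : β → Set (SimpleGraph V)) {E E' : Set (Sym2 V)} (hF : ∀ y, DeterminedBy {G | F G = y} E)
    (hEE' : Disjoint E E') (Q : β → Prop) (hH : ∀ y, Q y → DeterminedBy (H y) E')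
    (p : unitInterval) {c : ℝ} (hc0 : 0 ≤ c)
    (hc : ∀ y, Q y → (binomialRandom V p).real (H y) ≤ c) :
    (binomialRandom V p).real {G | Q (F G) ∧ G ∈ H (F G)} ≤ c := by
  classical
  cases nonempty_fintype β
  have h1 : {G | Q (F G) ∧ G ∈ H (F G)} =
      ⋃ y ∈ (Finset.univ.filter Q), ({G | F G = y} ∩ H y) := by
    ext G; simp
  have h2 : ∑ y ∈ Finset.univ.filter Q, (binomialRandom V p).real {G | F G = y} ≤ 1 := by
    rw [← measureReal_biUnion_finset]
    · exact measureReal_le_one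
    · intro x _ y _ hxy
      rw [Function.onFun, Set.disjoint_left]
      rintro G rfl h
      exact hxy h
    · intro _ _; exact MeasurableSet.of_discrete
  calc (binomialRandom V p).real {G | Q (F G) ∧ G ∈ H (F G)}
      ≤ ∑ y ∈ Finset.univ.filter Q, (binomialRandom V p).real ({G | F G = y} ∩ H y) := by
        rw [h1]; exact measureReal_biUnion_finset_le _ _
    _ ≤ ∑ y ∈ Finset.univ.filter Q, (binomialRandom V p).real {G | F G = y} * c := by
        refine Finset.sum_le_sum fun y hy => ?_
        have hQ := (Finset.mem_filter.1 hy).2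
        rw [(hF y).measureReal_inter (hH y hQ) hEE' p]
        exact mul_le_mul_of_nonneg_left (hc y hQ) measureReal_nonneg
    _ = (∑ y ∈ Finset.univ.filter Q, (binomialRandom V p).real {G | F G = y}) * c := by
        rw [Finset.sum_mul]
    _ ≤ 1 * c := by gcongr
    _ = c := one_mul c

end SimpleGraph

/-! ### Chernoff bounds -/

/-- Here (1 + x + x²/2)(1 - x + x²/2) = 1 + x⁴/4 ≥ 1. -/
theorem Real.exp_neg_le_quadratic {x : ℝ} (hx : 0 ≤ x) : Real.exp (-x) ≤ 1 - x + x ^ 2 / 2 := by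
  have h := Real.quadratic_le_exp_of_nonneg hx
  rw [Real.exp_neg]
  refine inv_le_of_inv_le₀ (by nlinarith [sq_nonneg (x - 1)]) (le_trans ?_ h)
  rw [inv_le_iff_one_le_mul₀ (by nlinarith [sq_nonneg (x - 1)])]
  nlinarith [sq_nonneg (x ^ 2)]

namespace SimpleGraph

variable {V : Type*} [Fintype V]

-- The exponential of a sum of indicators is a product of factors 1 + (e^t - 1)·1_A. Expanding over
-- subsets, integrating each term by independence and refolding gives the binomial form.
open Classical in
theorem mgf_card_filter {A : V → Set (SimpleGraph V)}
    {E : V → Set (Sym2 V)} (W : Finset V) (hA : ∀ v ∈ W, DeterminedBy (A v) (E v))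
    (hE : (W : Set V).PairwiseDisjoint E) (p : unitInterval) {q : ℝ}
    (hq : ∀ v ∈ W, (binomialRandom V p).real (A v) = q) (t : ℝ) :
    mgf (fun G => ((W.filter fun v => G ∈ A v).card : ℝ)) (binomialRandom V p) t =
      (1 + (Real.exp t - 1) * q) ^ W.card := by
  have h1 : ∀ G : SimpleGraph V, Real.exp (t * ((W.filter fun v => G ∈ A v).card : ℝ)) =
      ∑ T ∈ W.powerset, (Real.exp t - 1) ^ T.card * (⋂ v ∈ T, A v).indicator 1 G := by
    intro G
    have h2 : Real.exp (t * ((W.filter fun v => G ∈ A v).card : ℝ)) =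
        ∏ v ∈ W, (1 + (Real.exp t - 1) * (A v).indicator 1 G) := by
      rw [mul_comm, Real.exp_nat_mul, ← Finset.prod_const, Finset.prod_filter]
      refine Finset.prod_congr rfl fun v _ => ?_
      by_cases h : G ∈ A v <;> simp [h]
    rw [h2, Finset.prod_one_add]
    refine Finset.sum_congr rfl fun T _ => ?_
    rw [Finset.prod_mul_distrib, Finset.prod_const]
    congr 1
    by_cases h : G ∈ ⋂ v ∈ T, A v
    · rw [Set.indicator_of_mem h]
      refine Finset.prod_eq_one fun v hv => ?_
      simp only [Set.mem_iInter] at h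
      rw [Set.indicator_of_mem (h v hv)]
      rfl
    · rw [Set.indicator_of_notMem h]
      simp only [Set.mem_iInter, not_forall] at h
      obtain ⟨v, hv, hG⟩ := h
      exact Finset.prod_eq_zero hv (Set.indicator_of_notMem hG _)
  unfold mgf
  simp_rw [h1]
  rw [integral_finsetSum _ (fun T _ => Integrable.of_finite)]
  simp_rw [integral_const_mul, integral_indicator_one (MeasurableSet.of_discrete)]
  rw [← Finset.prod_const, Finset.prod_one_add]
  refine Finset.sum_congr rfl fun T hT => ?_
  rw [Finset.mem_powerset] at hT
  rw [measureReal_biInter_of_determinedBy T (fun v hv => hA v (hT hv))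
    (hE.subset (by exact_mod_cast hT)) p,
    Finset.prod_congr rfl (fun v hv => hq v (hT hv)), Finset.prod_const, Finset.prod_const, mul_pow]

-- Lower tail with tilt -δ. The exponent decreases in the mean, so a lower bound `m` for the mean is
-- enough.
open Classical in
theorem measureReal_card_filter_le {A : V → Set (SimpleGraph V)}
    {E : V → Set (Sym2 V)} (W : Finset V) (hA : ∀ v ∈ W, DeterminedBy (A v) (E v))
    (hE : (W : Set V).PairwiseDisjoint E) (p : unitInterval) {q m δ : ℝ}
    (hq : ∀ v ∈ W, (binomialRandom V p).real (A v) = q) (hδ : 0 ≤ δ) (hq0 : 0 ≤ q) (hq1 : q ≤ 1)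
    (hm : m ≤ W.card * q) (hm0 : 0 ≤ m) :
    (binomialRandom V p).real {G | ((W.filter fun v => G ∈ A v).card : ℝ) ≤ (1 - δ) * m} ≤
      Real.exp (-(δ ^ 2 * m / 2)) := by
  refine (measure_le_le_exp_mul_mgf (t := -δ) _ (by linarith) Integrable.of_finite).trans ?_
  rw [mgf_card_filter W hA hE p hq]
  have h1 : 0 ≤ 1 + (Real.exp (-δ) - 1) * q := by
    nlinarith [Real.exp_pos (-δ)]
  have h3 : Real.exp (-δ) - 1 ≤ -δ + δ ^ 2 / 2 := by
    linarith [Real.exp_neg_le_quadratic hδ]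
  have h2 : (1 + (Real.exp (-δ) - 1) * q) ^ W.card ≤ Real.exp ((-δ + δ ^ 2 / 2) * m) := by
    calc (1 + (Real.exp (-δ) - 1) * q) ^ W.card ≤ (Real.exp ((Real.exp (-δ) - 1) * q)) ^ W.card := by
          gcongr
          linarith [Real.add_one_le_exp ((Real.exp (-δ) - 1) * q)]
      _ = Real.exp ((Real.exp (-δ) - 1) * (W.card * q)) := by
          rw [← Real.exp_nat_mul]; congr 1; ring
      _ ≤ Real.exp ((Real.exp (-δ) - 1) * m) := by
          apply Real.exp_le_exp.2
          have : Real.exp (-δ) ≤ 1 := Real.exp_le_one_iff.2 (by linarith)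
          nlinarith
      _ ≤ _ := by gcongr
  calc _ ≤ Real.exp (- -δ * ((1 - δ) * m)) * Real.exp ((-δ + δ ^ 2 / 2) * m) := by gcongr
    _ = _ := by rw [← Real.exp_add]; congr 1; ring

-- Upper tail with tilt ε/2 and e^t ≤ 1 + t + t² for t ≤ 1; an upper bound `m` for the mean is
-- enough.
open Classical in
theorem measureReal_le_card_filter {A : V → Set (SimpleGraph V)}
    {E : V → Set (Sym2 V)} (W : Finset V) (hA : ∀ v ∈ W, DeterminedBy (A v) (E v))
    (hE : (W : Set V).PairwiseDisjoint E) (p : unitInterval) {q m ε : ℝ}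
    (hq : ∀ v ∈ W, (binomialRandom V p).real (A v) = q) (hε : 0 ≤ ε) (hε2 : ε ≤ 2) (hq0 : 0 ≤ q)
    (hm : W.card * q ≤ m) :
    (binomialRandom V p).real {G | (1 + ε) * m ≤ ((W.filter fun v => G ∈ A v).card : ℝ)} ≤
      Real.exp (-(ε ^ 2 * m / 4)) := by
  refine (measure_ge_le_exp_mul_mgf (t := ε / 2) _ (by linarith) Integrable.of_finite).trans ?_
  rw [mgf_card_filter W hA hE p hq]
  have hm0 : 0 ≤ m := le_trans (by positivity) hm
  have h3 : Real.exp (ε / 2) - 1 ≤ ε / 2 + (ε / 2) ^ 2 := by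
    have := Real.abs_exp_sub_one_sub_id_le (x := ε / 2) (by rw [abs_of_nonneg] <;> linarith)
    linarith [(abs_le.1 this).2]
  have h4 : 0 ≤ Real.exp (ε / 2) - 1 := by
    linarith [Real.add_one_le_exp (ε / 2)]
  have h2 : (1 + (Real.exp (ε / 2) - 1) * q) ^ W.card ≤
      Real.exp ((ε / 2 + (ε / 2) ^ 2) * m) := by
    calc _ ≤ (Real.exp ((Real.exp (ε / 2) - 1) * q)) ^ W.card := by
          gcongr
          linarith [Real.add_one_le_exp ((Real.exp (ε / 2) - 1) * q)]
      _ = Real.exp ((Real.exp (ε / 2) - 1) * (W.card * q)) := by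
          rw [← Real.exp_nat_mul]; congr 1; ring
      _ ≤ Real.exp ((Real.exp (ε / 2) - 1) * m) := by gcongr
      _ ≤ _ := by gcongr
  calc _ ≤ Real.exp (-(ε / 2) * ((1 + ε) * m)) * Real.exp ((ε / 2 + (ε / 2) ^ 2) * m) := by gcongr
    _ = _ := by rw [← Real.exp_add]; congr 1; ring

end SimpleGraph

/-! ### The robber's survival strategy -/

/-- König's lemma, as compactness of `ℕ → V`. It is needed because one and the same infinite walk
must escape location in every round. -/
theorem exists_walk_forall_mem {V : Type*} [Finite V] (G : SimpleGraph V) (B : ℕ → Finset V)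
    (h : ∀ t, ∃ w : ℕ → V, IsRobberWalk G w ∧ ∀ j ≤ t, w j ∈ B j) :
    ∃ w : ℕ → V, IsRobberWalk G w ∧ ∀ j, w j ∈ B j := by
  let _ : TopologicalSpace V := ⊥
  have _ : DiscreteTopology V := ⟨rfl⟩
  set K : ℕ → Set (ℕ → V) := fun t => {w | IsRobberWalk G w ∧ ∀ j ≤ t, w j ∈ B j} with hK
  have hclosed : ∀ t, IsClosed (K t) := by
    intro t
    have : K t = (⋂ s, (fun w : ℕ → V => (w s, w (s + 1))) ⁻¹'
        {x | x.2 = x.1 ∨ G.Adj x.1 x.2}) ∩ ⋂ j, ⋂ (_ : j ≤ t), (fun w : ℕ → V => w j) ⁻¹' (B j) := by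
      ext w
      simp [hK, IsRobberWalk]
    rw [this]
    refine (isClosed_iInter fun s => (isClosed_discrete _).preimage (by fun_prop)).inter
      (isClosed_iInter fun j => isClosed_iInter fun _ => (isClosed_discrete _).preimage
        (by fun_prop))
  obtain ⟨w, hw⟩ := IsCompact.nonempty_iInter_of_sequence_nonempty_isCompact_isClosed K
    (fun t w hw => ⟨hw.1, fun j hj => hw.2 j (by omega)⟩) (fun t => h t) (hclosed 0).isCompact
    hclosed
  rw [Set.mem_iInter] at hw
  exact ⟨w, (hw 0).1, fun j => (hw j).2 j le_rfl⟩

/-- If the robber can keep `a ≥ 2` candidate positions with the same signature, whatever the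
sensors, then the cops cannot win. -/
theorem not_copsWin_of_forall_exists {V : Type*} [Fintype V] (G : SimpleGraph V) {k a : ℕ}
    (ha : 2 ≤ a) (hcard : a ≤ Fintype.card V)
    (h : ∀ S : Finset V, S.card = k → ∀ A : Finset V, A.card = a → ∃ A' : Finset V, A'.card = a ∧
      (∀ v ∈ A', ∃ u ∈ A, v = u ∨ G.Adj u v) ∧
      ∀ v ∈ A', ∀ w ∈ A', signature G S v = signature G S w) : ¬ CopsWin G k := by
  rintro ⟨σ, hσ⟩
  choose! next hnext1 hnext2 hnext3 using h
  obtain ⟨A₀, -, hA₀⟩ := Finset.exists_subset_card_eq (s := (Finset.univ : Finset V)) (n := a)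
    (by simpa using hcard)
  have hV : Nonempty V := by
    obtain ⟨v, -⟩ := Finset.card_pos.1 (show 0 < A₀.card by omega)
    exact ⟨v⟩
  have hrep : ∀ A : Finset V, ∃ v, A.card = a → v ∈ A := fun A => by
    by_cases hA : A.card = a
    · obtain ⟨v, hv⟩ := Finset.card_pos.1 (show 0 < A.card by omega)
      exact ⟨v, fun _ => hv⟩
    · exact ⟨hV.some, fun h => absurd h hA⟩
  choose rep hrep using hrep
  -- The game is determined although no walk has been chosen: all candidates of a round share one
  -- signature, so the trail can be computed from any representative.
  let st : ℕ → List (V → Option ℕ∞) × Finset V := fun t => Nat.rec ([], A₀)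
    (fun _ s => (s.1 ++ [signature G (σ.sensors s.1) (rep (next (σ.sensors s.1) s.2))],
      next (σ.sensors s.1) s.2)) t
  have hst : ∀ t, st (t + 1) = ((st t).1 ++ [signature G (σ.sensors (st t).1)
      (rep (next (σ.sensors (st t).1) (st t).2))], next (σ.sensors (st t).1) (st t).2) :=
    fun t => rfl
  have hc : ∀ t, (st t).2.card = a := by
    intro t
    induction t with
    | zero => exact hA₀
    | succ t ih => rw [hst]; exact hnext1 _ (σ.card_sensors _) _ ih
  set B : ℕ → Finset V := fun t => (st (t + 1)).2 with hB
  have hsig : ∀ t, ∀ v ∈ B t, (st (t + 1)).1 = (st t).1 ++ [signature G (σ.sensors (st t).1) v] := by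
    intro t v hv
    rw [hst]
    have hv' : v ∈ next (σ.sensors (st t).1) (st t).2 := hv
    simp only
    rw [hnext3 _ (σ.card_sensors _) _ (hc t) _ (hrep _ (hc (t + 1))) v hv']
  have htrail : ∀ w : ℕ → V, ∀ t, (∀ j < t, w j ∈ B j) → infoTrail G σ w t = (st t).1 := by
    intro w t
    induction t with
    | zero => intro _; rfl
    | succ t ih =>
      intro hw
      rw [infoTrail, ih (fun j hj => hw j (by omega)), hsig t (w t) (hw t (by omega))]
  have hwalk : ∀ t, ∀ v ∈ B t, ∃ w : ℕ → V, IsRobberWalk G w ∧ (∀ j ≤ t, w j ∈ B j) ∧ w t = v := by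
    intro t
    induction t with
    | zero => exact fun v hv => ⟨fun _ => v, fun _ => Or.inl rfl, by simpa using hv, rfl⟩
    | succ t ih =>
      intro v hv
      obtain ⟨u, hu, huv⟩ := hnext2 (σ.sensors (st (t + 1)).1) (σ.card_sensors _) (st (t + 1)).2
        (hc (t + 1)) v hv
      obtain ⟨w, hw, hwB, hwt⟩ := ih u hu
      -- The walk moves to `v` in round `t + 1` and rests there, which makes the finite walk
      -- infinite.
      refine ⟨fun j => if j ≤ t then w j else v, fun j => ?_, fun j hj => ?_, by simp⟩
      · rcases lt_trichotomy j t with hj | rfl | hj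
        · simpa [hj.le, show j + 1 ≤ t by omega] using hw j
        · simpa [hwt] using huv
        · simp [show ¬ j ≤ t by omega, show ¬ j + 1 ≤ t by omega]
      · dsimp only
        split_ifs with hjt
        · exact hwB j hjt
        · obtain rfl : j = t + 1 := by omega
          exact hv
  obtain ⟨w, hw, hwB⟩ := exists_walk_forall_mem G B (fun t => by
    obtain ⟨w, h1, h2, -⟩ := hwalk t (rep (B t)) (hrep _ (hc (t + 1)))
    exact ⟨w, h1, h2⟩)
  obtain ⟨t, ht⟩ := hσ w hw
  -- A second candidate `y` is the end of another walk with the same trail, so the robber is not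
  -- located.
  obtain ⟨y, hy, hyw⟩ := Finset.exists_mem_ne (show 1 < (B t).card by rw [hc (t + 1)]; omega) (w t)
  obtain ⟨x, hx, hxB, hxt⟩ := hwalk t y hy
  refine hyw (hxt.symm.trans (ht x hx ?_))
  rw [htrail x (t + 1) (fun j hj => hxB j (by omega)), htrail w (t + 1) (fun j _ => hwB j)]

theorem copsWin_card {V : Type*} [Fintype V] (G : SimpleGraph V) : CopsWin G (Fintype.card V) := by
  refine ⟨⟨fun _ => Finset.univ, fun _ => rfl⟩, fun w _ => ⟨0, fun x _ hxw => ?_⟩⟩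
  simp only [infoTrail, List.nil_append, List.cons.injEq, and_true] at hxw
  have := congrFun hxw (w 0)
  have h0 : G.edist (w 0) (x 0) = 0 := by simpa [signature] using this
  exact (SimpleGraph.edist_eq_zero_iff.1 h0).symm

theorem lt_localizationNumber {V : Type*} [Fintype V] [Nonempty V] (G : SimpleGraph V) {K : ℝ}
    (h : ∀ k : ℕ, 1 ≤ k → (k : ℝ) < K → ¬ CopsWin G k) : K ≤ localizationNumber G := by
  -- Without nonemptiness the infimum would be the default value 0.
  have hne : {k | 1 ≤ k ∧ CopsWin G k}.Nonempty :=
    ⟨_, Fintype.card_pos, copsWin_card G⟩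
  have hmem := Nat.sInf_mem hne
  by_contra! hlt
  exact h _ hmem.1 hlt hmem.2

/-! ### Balls, and deterministic conditions under which the cops lose -/

namespace SimpleGraph

variable {V : Type*} [Fintype V]

open Classical in
/-- The closed neighbourhood of a set of vertices. -/
noncomputable def closedNbhd (G : SimpleGraph V) (X : Finset V) : Finset V :=
  Finset.univ.filter fun v => v ∈ X ∨ ∃ u ∈ X, G.Adj u v

/-- The vertices at distance at most `j` from the set `X`. -/
noncomputable def ballAround (G : SimpleGraph V) (X : Finset V) (j : ℕ) : Finset V :=
  (closedNbhd G)^[j] X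

theorem mem_closedNbhd {G : SimpleGraph V} {X : Finset V} {v : V} :
    v ∈ closedNbhd G X ↔ v ∈ X ∨ ∃ u ∈ X, G.Adj u v := by
  simp [closedNbhd]

theorem subset_closedNbhd (G : SimpleGraph V) (X : Finset V) : X ⊆ closedNbhd G X :=
  fun _ hv => mem_closedNbhd.2 (Or.inl hv)

theorem ballAround_zero (G : SimpleGraph V) (X : Finset V) : ballAround G X 0 = X := rfl

theorem ballAround_succ (G : SimpleGraph V) (X : Finset V) (j : ℕ) :
    ballAround G X (j + 1) = closedNbhd G (ballAround G X j) :=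
  Function.iterate_succ_apply' _ _ _

theorem ballAround_mono (G : SimpleGraph V) (X : Finset V) : Monotone (ballAround G X) :=
  monotone_nat_of_le_succ fun j => by
    rw [ballAround_succ]; exact subset_closedNbhd G _

theorem Walk.mem_ballAround {G : SimpleGraph V} {u v : V} (w : G.Walk u v) {X : Finset V}
    (hu : u ∈ X) : v ∈ ballAround G X w.length := by
  induction w generalizing X with
  | nil => exact hu
  | cons h w ih =>
    exact ih (X := closedNbhd G X) (mem_closedNbhd.2 (Or.inr ⟨_, hu, h⟩))

theorem mem_ballAround_of_edist_le {G : SimpleGraph V} {X : Finset V} {s v : V} (hs : s ∈ X)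
    {j : ℕ} (h : G.edist s v ≤ j) : v ∈ ballAround G X j := by
  obtain ⟨w, hw⟩ := exists_walk_of_edist_ne_top (ne_top_of_le_ne_top (ENat.natCast_ne_top j) h)
  refine ballAround_mono G X ?_ (w.mem_ballAround hs)
  rw [← hw] at h
  exact_mod_cast h

theorem edist_le_of_mem_ballAround {G : SimpleGraph V} {s v : V} {j : ℕ}
    (h : v ∈ ballAround G {s} j) : G.edist s v ≤ j := by
  induction j generalizing v with
  | zero =>
    have : v = s := by simpa [ballAround_zero] using h
    subst this
    simp
  | succ j ih =>
    rw [ballAround_succ, mem_closedNbhd] at h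
    rcases h with h | ⟨u, hu, huv⟩
    · exact (ih h).trans (by exact_mod_cast Nat.le_succ j)
    · calc G.edist s v ≤ G.edist s u + G.edist u v := SimpleGraph.edist_triangle
        _ ≤ (j : ℕ∞) + 1 := add_le_add (ih hu) (edist_eq_one_iff_adj.2 huv).le
        _ = ((j + 1 : ℕ) : ℕ∞) := by push_cast; rfl

theorem card_closedNbhd_le {G : SimpleGraph V} {D : ℝ}
    (hD : ∀ v, ((closedNbhd G {v}).card : ℝ) ≤ D) (X : Finset V) :
    ((closedNbhd G X).card : ℝ) ≤ X.card * D := by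
  classical
  have h1 : closedNbhd G X ⊆ X.biUnion fun x => closedNbhd G {x} := by
    intro v hv
    rw [mem_closedNbhd] at hv
    rw [Finset.mem_biUnion]
    rcases hv with hv | ⟨u, hu, huv⟩
    · exact ⟨v, hv, by simp [mem_closedNbhd]⟩
    · exact ⟨u, hu, by simp [mem_closedNbhd, huv]⟩
  calc ((closedNbhd G X).card : ℝ) ≤ ∑ x ∈ X, ((closedNbhd G {x}).card : ℝ) := by
        exact_mod_cast (Finset.card_le_card h1).trans Finset.card_biUnion_le
    _ ≤ ∑ x ∈ X, D := Finset.sum_le_sum fun x _ => hD x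
    _ = _ := by simp

theorem card_ballAround_le {G : SimpleGraph V} {D : ℝ} (hD0 : 0 ≤ D)
    (hD : ∀ v, ((closedNbhd G {v}).card : ℝ) ≤ D) (X : Finset V) (j : ℕ) :
    ((ballAround G X j).card : ℝ) ≤ X.card * D ^ j := by
  induction j with
  | zero => simp [ballAround_zero]
  | succ j ih =>
    rw [ballAround_succ, pow_succ, ← mul_assoc]
    exact (card_closedNbhd_le hD _).trans (by gcongr)

end SimpleGraph

namespace SimpleGraph

theorem signature_eq_of_forall_edist {V : Type*} {G : SimpleGraph V} {S : Finset V} {v w : V}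
    (h : ∀ s ∈ S, G.edist s v = G.edist s w) : signature G S v = signature G S w := by
  funext s
  unfold signature
  split_ifs with hs
  · rw [h s hs]
  · rfl

variable {V : Type*} [Fintype V]

open Classical in
/-- If, from any `2 m` candidate positions, the robber can reach `3 m` vertices outside the balls of
radius `j + 1` around the sensors, and fewer than `m` pairs are at distance more than `j + 2`, then
the cops cannot win. -/
theorem not_copsWin_of_expansion (G : SimpleGraph V) {k j m : ℕ} {D : ℝ} (hm : 1 ≤ m)
    (hmV : 2 * m ≤ Fintype.card V) (hD0 : 0 ≤ D)
    (hD : ∀ v, ((closedNbhd G {v}).card : ℝ) ≤ D) (hk : k * D ^ j ≤ m)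
    (hexp : ∀ B A : Finset V, Disjoint B A → B.card = m → A.card = m →
      3 * m ≤ ((B ∪ A)ᶜ.filter fun v => (∀ x ∈ B, ¬ G.Adj v x) ∧ ∃ x ∈ A, G.Adj v x).card)
    (hfar : (Finset.univ.filter fun x : V × V => ((j + 2 : ℕ) : ℕ∞) < G.edist x.1 x.2).card < m) :
    ¬ CopsWin G k := by
  refine not_copsWin_of_forall_exists G (a := 2 * m) (by omega) hmV fun S hS A hA => ?_
  have hball : (ballAround G S j).card ≤ m := by
    have := card_ballAround_le hD0 hD S j
    rw [hS] at this
    exact_mod_cast this.trans hk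
  obtain ⟨A', hA'A, hA'⟩ := Finset.exists_subset_card_eq
    (s := A \ ballAround G S j) (n := m)
    (by have := Finset.le_card_sdiff (ballAround G S j) A; omega)
  -- The union of balls is padded to exactly `m` vertices off `A'`, since the expansion property
  -- concerns pairs of sets of that size.
  obtain ⟨B, hB1, hB2, hB⟩ := Finset.exists_subsuperset_card_eq
    (s := ballAround G S j) (t := A'ᶜ) (n := m)
    (fun v hv => by
      rw [Finset.mem_compl]
      intro hvA
      exact (Finset.mem_sdiff.1 (hA'A hvA)).2 hv) hball
    (by rw [Finset.card_compl]; omega)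
  set Z := ((B ∪ A')ᶜ.filter fun v => (∀ x ∈ B, ¬ G.Adj v x) ∧ ∃ x ∈ A', G.Adj v x) with hZ
  have hZcard : 3 * m ≤ Z.card := hexp B A' (Finset.disjoint_left.2 fun v hv =>
    Finset.mem_compl.1 (hB2 hv)) hB hA'
  -- Vertices too far from anything are discarded for all sensors at once; fewer than `m` are lost,
  -- and 2m of the 3m remain.
  set R := (Finset.univ.filter fun x : V × V => ((j + 2 : ℕ) : ℕ∞) < G.edist x.1 x.2).image
    Prod.snd with hR
  have hRcard : R.card < m := lt_of_le_of_lt Finset.card_image_le hfar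
  obtain ⟨C, hCZ, hC⟩ := Finset.exists_subset_card_eq (s := Z \ R) (n := 2 * m)
    (by have := Finset.le_card_sdiff R Z; omega)
  have hdist : ∀ v ∈ C, ∀ s ∈ S, G.edist s v = ((j + 2 : ℕ) : ℕ∞) := by
    intro v hv s hs
    obtain ⟨hvZ, hvR⟩ := Finset.mem_sdiff.1 (hCZ hv)
    rw [hZ, Finset.mem_filter, Finset.mem_compl, Finset.mem_union, not_or] at hvZ
    refine le_antisymm ?_ ?_
    · by_contra! hlt
      exact hvR (Finset.mem_image.2 ⟨(s, v), by simpa using hlt, rfl⟩)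
    · by_contra! hlt
      have hle : G.edist s v ≤ ((j + 1 : ℕ) : ℕ∞) := by
        have : ((j + 2 : ℕ) : ℕ∞) = ((j + 1 : ℕ) : ℕ∞) + 1 := by push_cast; ring
        rw [this] at hlt
        exact Order.lt_add_one_iff_of_not_isMax (by simp) |>.1 hlt
      have := mem_ballAround_of_edist_le hs hle
      rw [ballAround_succ, mem_closedNbhd] at this
      rcases this with h | ⟨u, hu, huv⟩
      · exact hvZ.1.1 (hB1 h)
      · exact hvZ.2.1 u (hB1 hu) huv.symm
  refine ⟨C, hC, fun v hv => ?_, fun v hv w hw => signature_eq_of_forall_edist fun s hs => ?_⟩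
  · obtain ⟨x, hx, hvx⟩ := (Finset.mem_filter.1 (Finset.mem_sdiff.1 (hCZ hv)).1).2.2
    exact ⟨x, (Finset.mem_sdiff.1 (hA'A hx)).1, Or.inr hvx.symm⟩
  · rw [hdist v hv s hs, hdist w hw s hs]

/-- If the diameter is at most two and every neighbourhood contains two vertices that `K` sensors do
not distinguish, then the cops cannot win with at most `K` sensors. -/
theorem not_copsWin_of_twins (G : SimpleGraph V) {k K : ℕ} (hkK : k ≤ K)
    (hK : K ≤ Fintype.card V) (hV : 2 ≤ Fintype.card V) (hdiam : ∀ s v, G.edist s v ≤ 2)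
    (htwin : ∀ S : Finset V, S.card = K → ∀ u, ∃ v w, v ≠ w ∧ G.Adj u v ∧ G.Adj u w ∧ v ∉ S ∧
      w ∉ S ∧ ∀ s ∈ S, G.Adj v s ↔ G.Adj w s) : ¬ CopsWin G k := by
  classical
  refine not_copsWin_of_forall_exists G (a := 2) le_rfl hV fun S hS A hA => ?_
  -- Extra sensors only help the cops, so one size `K` covers every `k ≤ K`.
  obtain ⟨S', hSS', -, hS'⟩ := Finset.exists_subsuperset_card_eq (Finset.subset_univ S)
    (hS.trans_le hkK) (by simpa using hK)
  obtain ⟨u, hu⟩ := Finset.card_pos.1 (show 0 < A.card by omega)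
  obtain ⟨v, w, hvw, huv, huw, hv, hw, hs⟩ := htwin S' hS' u
  have hd : ∀ x, x ∉ S' → ∀ s ∈ S, ¬ G.Adj x s → G.edist s x = 2 := by
    intro x hx s hsS hxs
    refine le_antisymm (hdiam s x) ?_
    by_contra! hlt
    have hle : G.edist s x ≤ 1 := by
      have : (2 : ℕ∞) = 1 + 1 := by norm_num
      rw [this] at hlt
      exact Order.lt_add_one_iff_of_not_isMax (by simp) |>.1 hlt
    rcases edist_le_one_iff_adj_or_eq.1 hle with h | h
    · exact hxs h.symm
    · exact hx (h ▸ hSS' hsS)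
  have hsame : signature G S v = signature G S w := by
    refine signature_eq_of_forall_edist fun s hsS => ?_
    by_cases h : G.Adj v s
    · rw [edist_eq_one_iff_adj.2 h.symm, edist_eq_one_iff_adj.2 ((hs s (hSS' hsS)).1 h).symm]
    · rw [hd v hv s hsS h, hd w hw s hsS (fun h' => h ((hs s (hSS' hsS)).2 h'))]
  refine ⟨{v, w}, Finset.card_pair hvw, fun x hx => ⟨u, hu, Or.inr ?_⟩, fun x hx y hy => ?_⟩
  · rcases Finset.mem_insert.1 hx with rfl | hx
    · exact huv
    · rw [Finset.mem_singleton.1 hx]; exact huw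
  · simp only [Finset.mem_insert, Finset.mem_singleton] at hx hy
    rcases hx with hx | hx <;> rcases hy with hy | hy <;> simp [hx, hy, hsame]

end SimpleGraph

/-! ### Degrees, expansion, and vertices adjacent to one set but not to another -/

namespace SimpleGraph

variable {V : Type*}

theorem one_sub_pow_le_exp (p : unitInterval) (x : ℕ) :
    (1 - p : ℝ) ^ x ≤ Real.exp (-(p * x)) := by
  calc (1 - p : ℝ) ^ x ≤ Real.exp (-p) ^ x := by
        gcongr
        · linarith [p.2.2]
        · linarith [Real.add_one_le_exp (-(p : ℝ))]
    _ = _ := by rw [← Real.exp_nat_mul]; congr 1; ring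

theorem disjoint_compl_pairsTo [Fintype V] [DecidableEq V] (X : Finset V) :
    ((Xᶜ : Finset V) : Set V).PairwiseDisjoint (fun v => pairsTo v X) :=
  pairwiseDisjoint_pairsTo disjoint_compl_right

variable [Fintype V]

theorem measureReal_forall_card_closedNbhd_compl_le (p : unitInterval) {ε : ℝ} (hε : 0 ≤ ε)
    (hε2 : ε ≤ 2) :
    (binomialRandom V p).real
      {G | ∀ v, ((closedNbhd G {v}).card : ℝ) ≤ (1 + ε) * (p * Fintype.card V) + 1}ᶜ ≤
      Fintype.card V * Real.exp (-(ε ^ 2 * (p * Fintype.card V) / 4)) := by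
  classical
  have h1 : {G : SimpleGraph V |
      ∀ v, ((closedNbhd G {v}).card : ℝ) ≤ (1 + ε) * (p * Fintype.card V) + 1}ᶜ ⊆
      ⋃ v ∈ (Finset.univ : Finset V), {G | (1 + ε) * (p * Fintype.card V) ≤
        (((({v} : Finset V)ᶜ).filter fun w => G ∈ {G : SimpleGraph V | G.Adj w v}).card : ℝ)} := by
    intro G hG
    simp only [Set.mem_compl_iff, Set.mem_ofPred_eq, not_forall, not_le] at hG
    obtain ⟨v, hv⟩ := hG
    simp only [Set.mem_iUnion]
    refine ⟨v, Finset.mem_univ _, ?_⟩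
    simp only [Set.mem_ofPred_eq]
    have h2 : closedNbhd G {v} ⊆ insert v ((({v} : Finset V)ᶜ).filter fun w => G.Adj w v) := by
      intro w hw
      simp only [mem_closedNbhd, Finset.mem_singleton, exists_eq_left] at hw
      simp only [Finset.mem_insert, Finset.mem_filter, Finset.mem_compl, Finset.mem_singleton]
      rcases hw with hw | hw
      · exact Or.inl hw
      · exact Or.inr ⟨hw.ne', hw.symm⟩
    have h3 := (Finset.card_le_card h2).trans (Finset.card_insert_le _ _)
    have h4 : ((closedNbhd G {v}).card : ℝ) ≤
      (((({v} : Finset V)ᶜ).filter fun w => G.Adj w v).card : ℝ) + 1 := by exact_mod_cast h3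
    linarith
  calc _ ≤ ∑ v ∈ (Finset.univ : Finset V), (binomialRandom V p).real
        {G | (1 + ε) * (p * Fintype.card V) ≤
        (((({v} : Finset V)ᶜ).filter fun w => G ∈ {G : SimpleGraph V | G.Adj w v}).card : ℝ)} :=
        (measureReal_mono h1 (measure_ne_top _ _)).trans (measureReal_biUnion_finset_le _ _)
    _ ≤ ∑ v ∈ (Finset.univ : Finset V), Real.exp (-(ε ^ 2 * (p * Fintype.card V) / 4)) := by
        refine Finset.sum_le_sum fun v _ => ?_
        refine measureReal_le_card_filter (A := fun w => {G : SimpleGraph V | G.Adj w v})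
          (E := fun w => pairsTo w {v}) (q := p) _
          (fun w _ => (determinedBy_adj w v).mono (by rintro e rfl; exact ⟨v, by simp, rfl⟩))
          (disjoint_compl_pairsTo _) p
          (fun w hw => measureReal_adj p (by simpa using hw)) hε hε2 p.2.1 ?_
        rw [mul_comm]
        have : ((({v} : Finset V)ᶜ).card : ℝ) ≤ Fintype.card V := by
          exact_mod_cast Finset.card_le_univ _
        exact mul_le_mul_of_nonneg_left this p.2.1
    _ = _ := by simp [Finset.card_univ]

open Classical in
/-- The number of vertices outside `X` with a neighbour in `X`. -/
noncomputable def boundaryCard (G : SimpleGraph V) (X : Finset V) : ℕ :=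
  (Xᶜ.filter fun v => ∃ x ∈ X, G.Adj v x).card

/-- Every set of at most `M` vertices has at least `c` times as many outer neighbours. -/
def Expands (G : SimpleGraph V) (c M : ℝ) : Prop :=
  ∀ X : Finset V, (X.card : ℝ) ≤ M → c * X.card ≤ boundaryCard G X

/-- Vertices outside `X` see `X` independently with probability at least px - (px)²/2, where x =
|X|. As px ≤ δ and x ≤ δN/2, the mean is at least (1 - δ)pNx, and Chernoff loses one more factor 1 -
δ. The bound is a power with exponent |X| so that it can be summed over all `X`. -/
theorem measureReal_boundaryCard_lt (p : unitInterval) {δ M : ℝ} (hδ : 0 ≤ δ)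
    (hδ2 : δ ≤ 1 / 2) (hM1 : p * M ≤ δ) (hM2 : M ≤ δ * Fintype.card V / 2) {X : Finset V}
    (hX : (X.card : ℝ) ≤ M) :
    (binomialRandom V p).real {G | (boundaryCard G X : ℝ) <
      (1 - 2 * δ) * (p * Fintype.card V) * X.card} ≤
      Real.exp (-(δ ^ 2 * (p * Fintype.card V) / 4)) ^ X.card := by
  classical
  set N : ℝ := ((Fintype.card V : ℕ) : ℝ) with hN
  set x : ℝ := ((X.card : ℕ) : ℝ) with hx
  have hp0 := p.2.1
  have hx0 : 0 ≤ x := by positivity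
  have hN0 : 0 ≤ N := by positivity
  have hq : (p : ℝ) * x - (p * x) ^ 2 / 2 ≤ 1 - (1 - p : ℝ) ^ X.card := by
    have h1 := one_sub_pow_le_exp p X.card
    have h2 := Real.exp_neg_le_quadratic (x := p * x) (by positivity)
    rw [← hx] at h1
    linarith
  have hpx : p * x ≤ δ := (mul_le_mul_of_nonneg_left hX hp0).trans hM1
  have hcard : ((Xᶜ.card : ℕ) : ℝ) = N - x := by
    rw [Finset.card_compl, Nat.cast_sub (Finset.card_le_univ _)]
  have hpow : 0 ≤ (1 - p : ℝ) ^ X.card ∧ (1 - p : ℝ) ^ X.card ≤ 1 :=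
    ⟨pow_nonneg (by linarith [p.2.2]) _, pow_le_one₀ (by linarith [p.2.2]) (by linarith)⟩
  have hmean : (1 - δ) * (p * N * x) ≤ Xᶜ.card * (1 - (1 - p : ℝ) ^ X.card) := by
    rw [hcard]
    calc (1 - δ) * (p * N * x) ≤ (N * (1 - δ / 2)) * (p * x * (1 - δ / 2)) := by
          have : 0 ≤ p * N * x := by positivity
          nlinarith [sq_nonneg δ]
      _ ≤ (N - x) * (p * x - (p * x) ^ 2 / 2) := by
          refine mul_le_mul (by linarith) ?_ ?_ (by nlinarith)
          · nlinarith [mul_nonneg hp0 hx0]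
          · exact mul_nonneg (by positivity) (by linarith)
      _ ≤ _ := by
          refine mul_le_mul_of_nonneg_left hq ?_
          nlinarith
  have hm0 : 0 ≤ (1 - δ) * (p * N * x) := mul_nonneg (by linarith) (by positivity)
  have key := measureReal_card_filter_le (A := fun v => {G : SimpleGraph V | ∀ x ∈ X, ¬ G.Adj v x}ᶜ)
    (E := fun v => pairsTo v X) Xᶜ (fun v _ => (determinedBy_not_adj v X).compl)
    (disjoint_compl_pairsTo X) p (q := 1 - (1 - p : ℝ) ^ X.card)
    (fun v hv => by
      rw [probReal_compl_eq_one_sub (MeasurableSet.of_discrete),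
        measureReal_not_adj p (by simpa using hv)]) hδ (by linarith [hpow.2]) (by linarith [hpow.1])
    hmean hm0
  refine ((measureReal_mono ?_).trans key).trans ?_
  · intro G hG
    simp only [Set.mem_ofPred_eq, boundaryCard] at hG ⊢
    refine le_trans (le_of_eq ?_) (hG.le.trans ?_)
    · congr 2
      ext v
      simp
    have : 0 ≤ p * N * x := by positivity
    nlinarith [mul_nonneg (sq_nonneg δ) this]
  · rw [← Real.exp_nat_mul]
    apply Real.exp_le_exp.2
    rw [← hx]
    have : 0 ≤ δ ^ 2 * (p * N * x) := by positivity
    nlinarith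

/-- Union bound: the sum of y^|X| over nonempty X is (1 + y)^N - 1 ≤ e^(Ny) - 1. -/
theorem measureReal_expands_compl_le (p : unitInterval) {δ M : ℝ} (hδ : 0 ≤ δ)
    (hδ2 : δ ≤ 1 / 2) (hM1 : p * M ≤ δ) (hM2 : M ≤ δ * Fintype.card V / 2) :
    (binomialRandom V p).real {G | Expands G ((1 - 2 * δ) * (p * Fintype.card V)) M}ᶜ ≤
      Real.exp (Fintype.card V * Real.exp (-(δ ^ 2 * (p * Fintype.card V) / 4))) - 1 := by
  classical
  set y := Real.exp (-(δ ^ 2 * (p * Fintype.card V) / 4)) with hy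
  have hy0 : 0 ≤ y := (Real.exp_pos _).le
  have h1 : {G : SimpleGraph V | Expands G ((1 - 2 * δ) * (p * Fintype.card V)) M}ᶜ ⊆
      ⋃ X ∈ ((Finset.univ : Finset (Finset V)).filter (fun X => (X.card : ℝ) ≤ M)).erase ∅,
        {G | (boundaryCard G X : ℝ) < (1 - 2 * δ) * (p * Fintype.card V) * X.card} := by
    intro G hG
    simp only [Expands, Set.mem_compl_iff, Set.mem_ofPred_eq, not_forall, not_le] at hG
    obtain ⟨X, hX, hlt⟩ := hG
    simp only [Set.mem_iUnion]
    refine ⟨X, ?_, hlt⟩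
    rw [Finset.mem_erase, Finset.mem_filter]
    refine ⟨?_, Finset.mem_univ _, hX⟩
    rintro rfl
    simp only [Finset.card_empty, Nat.cast_zero, mul_zero] at hlt
    exact absurd hlt (not_lt.2 (Nat.cast_nonneg _))
  calc _ ≤ ∑ X ∈ ((Finset.univ : Finset (Finset V)).filter (fun X => (X.card : ℝ) ≤ M)).erase ∅,
        (binomialRandom V p).real
        {G | (boundaryCard G X : ℝ) < (1 - 2 * δ) * (p * Fintype.card V) * X.card} :=
        (measureReal_mono h1 (measure_ne_top _ _)).trans (measureReal_biUnion_finset_le _ _)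
    _ ≤ ∑ X ∈ ((Finset.univ : Finset (Finset V)).filter (fun X => (X.card : ℝ) ≤ M)).erase ∅,
        y ^ X.card := by
        refine Finset.sum_le_sum fun X hX => ?_
        exact measureReal_boundaryCard_lt p hδ hδ2 hM1 hM2
          (Finset.mem_filter.1 (Finset.mem_of_mem_erase hX)).2
    _ ≤ ∑ X ∈ (Finset.univ : Finset (Finset V)).erase ∅, y ^ X.card := by
        refine Finset.sum_le_sum_of_subset_of_nonneg
          (Finset.erase_subset_erase _ (Finset.filter_subset _ _)) fun _ _ _ => by positivity
    _ = (1 + y) ^ Fintype.card V - 1 := by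
        rw [Finset.sum_erase_eq_sub (Finset.mem_univ _), Finset.card_empty, pow_zero,
          ← Finset.powerset_univ]
        congr 1
        have := Finset.sum_pow_mul_eq_add_pow y 1 (Finset.univ : Finset V)
        simp only [one_pow, mul_one, Finset.card_univ] at this
        rw [this, add_comm]
    _ ≤ _ := by
        gcongr
        rw [Real.exp_nat_mul]
        gcongr
        linarith [Real.add_one_le_exp y]

-- For fixed (B, A) the outer vertices are independent, each good with probability (1 - p)^m - (1 -
-- p)^(2m). Chernoff with δ = 1/2 is followed by a union bound over at most N^(2m) pairs.
open Classical in
theorem measureReal_exists_disjoint_le (p : unitInterval) {m : ℕ} {M : ℝ} (hM0 : 0 ≤ M)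
    (hM : M ≤ (Fintype.card V - 2 * m) * ((1 - p : ℝ) ^ m - (1 - p : ℝ) ^ (2 * m))) :
    (binomialRandom V p).real {G | ∀ B A : Finset V, Disjoint B A → B.card = m → A.card = m →
      M / 2 < (((B ∪ A)ᶜ.filter fun v =>
        (∀ x ∈ B, ¬ G.Adj v x) ∧ ∃ x ∈ A, G.Adj v x).card : ℝ)}ᶜ ≤
      (Fintype.card V : ℝ) ^ (2 * m) * Real.exp (-(M / 8)) := by
  have hp0 := p.2.1
  have hp1 := p.2.2
  set P := (((Finset.univ : Finset V).powersetCard m) ×ˢ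
    ((Finset.univ : Finset V).powersetCard m)).filter (fun x => Disjoint x.1 x.2) with hP
  have h1 : {G : SimpleGraph V | ∀ B A : Finset V, Disjoint B A → B.card = m → A.card = m →
      M / 2 < (((B ∪ A)ᶜ.filter fun v =>
        (∀ x ∈ B, ¬ G.Adj v x) ∧ ∃ x ∈ A, G.Adj v x).card : ℝ)}ᶜ ⊆
      ⋃ x ∈ P, {G | (((x.1 ∪ x.2)ᶜ.filter fun v =>
        (∀ y ∈ x.1, ¬ G.Adj v y) ∧ ∃ y ∈ x.2, G.Adj v y).card : ℝ) ≤ M / 2} := by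
    intro G hG
    simp only [Set.mem_compl_iff, Set.mem_ofPred_eq, not_forall, not_lt] at hG
    obtain ⟨B, A, hBA, hB, hA, hle⟩ := hG
    simp only [Set.mem_iUnion]
    refine ⟨(B, A), ?_, hle⟩
    simp [hP, Finset.mem_powersetCard, hB, hA, hBA]
  have hbound : ∀ x ∈ P, (binomialRandom V p).real {G | (((x.1 ∪ x.2)ᶜ.filter fun v =>
        (∀ y ∈ x.1, ¬ G.Adj v y) ∧ ∃ y ∈ x.2, G.Adj v y).card : ℝ) ≤ M / 2} ≤
      Real.exp (-(M / 8)) := by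
    rintro ⟨B, A⟩ hx
    simp only [hP, Finset.mem_filter, Finset.mem_product, Finset.mem_powersetCard,
      Finset.subset_univ, true_and] at hx
    obtain ⟨⟨hB, hA⟩, hBA⟩ := hx
    have hUcard : (B ∪ A).card = 2 * m := by
      rw [Finset.card_union_of_disjoint hBA, hB, hA]; ring
    have hq1 : (1 - p : ℝ) ^ (2 * m) ≤ (1 - p : ℝ) ^ m :=
      pow_le_pow_of_le_one (by linarith) (by linarith) (by omega)
    have hcompl : (((B ∪ A)ᶜ.card : ℕ) : ℝ) = Fintype.card V - 2 * m := by
      rw [Finset.card_compl, Nat.cast_sub (Finset.card_le_univ _), hUcard]; push_cast; ring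
    have hm0 : (1 - p : ℝ) ^ m ≤ 1 := pow_le_one₀ (by linarith) (by linarith)
    have hm1 : 0 ≤ (1 - p : ℝ) ^ (2 * m) := pow_nonneg (by linarith) _
    have key := measureReal_card_filter_le
      (A := fun v => {G : SimpleGraph V | ∀ y ∈ B, ¬ G.Adj v y} \
          {G : SimpleGraph V | ∀ y ∈ B ∪ A, ¬ G.Adj v y}) (E := fun v => pairsTo v (B ∪ A))
      (B ∪ A)ᶜ (fun v _ => DeterminedBy.inter ((determinedBy_not_adj v B).mono (by
        rintro e ⟨x, hx, rfl⟩
        exact ⟨x, Finset.mem_union_left _ hx, rfl⟩)) (determinedBy_not_adj v _).compl)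
      (disjoint_compl_pairsTo _) p
      (q := (1 - p : ℝ) ^ m - (1 - p : ℝ) ^ (2 * m)) (m := M) (fun v hv => by
        rw [Finset.mem_compl] at hv
        have hsub : {G : SimpleGraph V | ∀ y ∈ B ∪ A, ¬ G.Adj v y} ⊆
            {G : SimpleGraph V | ∀ y ∈ B, ¬ G.Adj v y} :=
          fun G hG y hy => hG y (Finset.mem_union_left _ hy)
        rw [measureReal_sdiff hsub MeasurableSet.of_discrete, measureReal_not_adj p hv, measureReal_not_adj p
          (fun h => hv (Finset.mem_union_left _ h)), hB, hUcard]) (δ := 1 / 2) (by norm_num)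
      (by linarith) (by linarith) (by rw [hcompl]; exact hM) hM0
    refine (measureReal_mono ?_ (measure_ne_top _ _)).trans
      (key.trans (le_of_eq (by congr 1; ring)))
    intro G hG
    simp only [Set.mem_ofPred_eq] at hG ⊢
    refine le_trans (le_of_eq ?_) (hG.trans (by linarith))
    congr 2
    ext v
    simp only [Set.mem_sdiff, Set.mem_ofPred_eq, Finset.mem_union, not_forall, not_not,
      Finset.mem_filter]
    refine and_congr_right fun _ => ⟨?_, ?_⟩
    · rintro ⟨h, y, hy | hy, hvy⟩
      · exact absurd hvy (h y hy)
      · exact ⟨h, y, hy, hvy⟩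
    · rintro ⟨h, y, hy, hvy⟩
      exact ⟨h, y, Or.inr hy, hvy⟩
  calc _ ≤ ∑ x ∈ P, Real.exp (-(M / 8)) :=
        ((measureReal_mono h1 (measure_ne_top _ _)).trans (measureReal_biUnion_finset_le _ _)).trans
          (Finset.sum_le_sum hbound)
    _ = P.card * Real.exp (-(M / 8)) := by simp
    _ ≤ _ := by
        gcongr
        calc (P.card : ℝ) ≤ (((Fintype.card V).choose m * (Fintype.card V).choose m : ℕ) : ℝ) := by
              refine Nat.cast_le.2 ((Finset.card_filter_le _ _).trans (le_of_eq ?_))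
              rw [Finset.card_product, Finset.card_powersetCard, Finset.card_univ]
          _ ≤ (((Fintype.card V) ^ m * (Fintype.card V) ^ m : ℕ) : ℝ) := by
              refine Nat.cast_le.2 (Nat.mul_le_mul ?_ ?_) <;> exact Nat.choose_le_pow _ _
          _ = _ := by push_cast; ring

end SimpleGraph

/-! ### Few pairs of vertices are far apart -/

namespace SimpleGraph

variable {V : Type*} [Fintype V]

/-- Expansion survives isolating `v` at no cost: one boundary vertex may be lost, but the closed
neighbourhood also contains the nonempty set itself. Passing to a subset of size ⌈b⌉ keeps within
the size limit `M`. -/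
theorem le_card_closedNbhd_deleteIncidenceSet {G : SimpleGraph V} {v : V} {c M b : ℝ} (hc : 0 ≤ c)
    (hb0 : 0 ≤ b) (hbM : b + 1 ≤ M) (hG : Expands G c M) {X : Finset V} (hv : v ∉ X)
    (hb : b ≤ X.card) : c * b ≤ (closedNbhd (G.deleteIncidenceSet v) X).card := by
  classical
  rcases hb0.eq_or_lt with rfl | hbpos
  · simp
  obtain ⟨Y, hYX, hY⟩ := Finset.exists_subset_card_eq (s := X) (n := ⌈b⌉₊) (Nat.ceil_le.2 hb)
  have hY1 : 1 ≤ Y.card := by rw [hY]; exact Nat.ceil_pos.2 hbpos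
  have hbY : b ≤ Y.card := by rw [hY]; exact Nat.le_ceil b
  have hexp := hG Y (by rw [hY]; exact (Nat.ceil_lt_add_one hb0).le.trans hbM)
  unfold boundaryCard at hexp
  set Z := Yᶜ.filter fun w => ∃ x ∈ Y, G.Adj w x with hZ
  have hsub : (Y ∪ Z).erase v ⊆ closedNbhd (G.deleteIncidenceSet v) X := by
    intro w hw
    rw [Finset.mem_erase, Finset.mem_union] at hw
    rw [mem_closedNbhd]
    rcases hw.2 with h | h
    · exact Or.inl (hYX h)
    · obtain ⟨x, hx, hwx⟩ := (Finset.mem_filter.1 h).2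
      refine Or.inr ⟨x, hYX hx, ?_⟩
      rw [deleteIncidenceSet_adj]
      exact ⟨hwx.symm, fun h => hv (h ▸ hYX hx), hw.1⟩
  have hdisj : Disjoint Y Z := Finset.disjoint_left.2 fun w hw hwZ =>
    Finset.mem_compl.1 (Finset.mem_filter.1 hwZ).1 hw
  have h1 := Finset.card_le_card hsub
  have h2 := Finset.pred_card_le_card_erase (s := Y ∪ Z) (a := v)
  rw [Finset.card_union_of_disjoint hdisj] at h2
  have h3 : Z.card ≤ (closedNbhd (G.deleteIncidenceSet v) X).card := by omega
  calc c * b ≤ c * Y.card := by gcongr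
    _ ≤ Z.card := hexp
    _ ≤ _ := by exact_mod_cast h3

theorem notMem_ballAround_deleteIncidenceSet (G : SimpleGraph V) {s v : V} (h : s ≠ v) (j : ℕ) :
    v ∉ ballAround (G.deleteIncidenceSet v) {s} j := by
  induction j with
  | zero => simpa [ballAround_zero] using h.symm
  | succ j ih =>
    rw [ballAround_succ, mem_closedNbhd, not_or]
    refine ⟨ih, ?_⟩
    rintro ⟨u, -, hu⟩
    rw [deleteIncidenceSet_adj] at hu
    exact hu.2.2 rfl

theorem pow_le_card_ballAround_deleteIncidenceSet {G : SimpleGraph V} {s v : V} (h : s ≠ v)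
    {c M : ℝ} (hc : 0 ≤ c) (hG : Expands G c M) (j : ℕ) (hM : ∀ t < j, c ^ t + 1 ≤ M) :
    c ^ j ≤ (ballAround (G.deleteIncidenceSet v) {s} j).card := by
  induction j with
  | zero => simp [ballAround_zero]
  | succ j ih =>
    rw [ballAround_succ, pow_succ']
    exact le_card_closedNbhd_deleteIncidenceSet hc (by positivity) (hM j (by omega)) hG
      (notMem_ballAround_deleteIncidenceSet G h j) (ih fun t ht => hM t (by omega))

/-- The ball of radius j + 1 about `s` in the graph with `v` isolated is independent of the edges at
`v`. If `v` is at distance more than j + 2, it has no neighbour in this ball. The ball is large: `j`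
steps use the rate `c₁`, and the last step uses `c₂`, which may hold for larger sets. -/
theorem measureReal_lt_edist_le (p : unitInterval) {s v : V} (h : s ≠ v) {c₁ c₂ M₁ M₂ : ℝ} {j : ℕ}
    (hc₁ : 0 ≤ c₁) (hc₂ : 0 ≤ c₂) (hM₁ : ∀ t < j, c₁ ^ t + 1 ≤ M₁) (hM₂ : 1 ≤ M₂) :
    (binomialRandom V p).real {G | (Expands G c₁ M₁ ∧ Expands G c₂ M₂) ∧
      ((j + 2 : ℕ) : ℕ∞) < G.edist s v} ≤ Real.exp (-(p * (c₂ * min (c₁ ^ j) (M₂ - 1)))) := by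
  classical
  set x := c₂ * min (c₁ ^ j) (M₂ - 1) with hx
  have hmain := measureReal_exists_le (V := V)
    (F := fun G => ballAround (G.deleteIncidenceSet v) {s} (j + 1))
    (H := fun X => {G : SimpleGraph V | ∀ y ∈ X, ¬ G.Adj v y}) (E := {e | v ∉ e}) (E' := {e | v ∈ e})
    (fun X G H hGH hG => by
      have : H.deleteIncidenceSet v = G.deleteIncidenceSet v := by
        ext a b
        simp only [deleteIncidenceSet_adj]
        refine and_congr_left fun hab => ?_
        have := hGH s(a, b) (by simp [hab.1.symm, hab.2.symm])
        simpa using this.symm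
      simpa [this] using hG)
    (Set.disjoint_left.2 fun e h1 h2 => h1 h2) (fun X => v ∉ X ∧ x ≤ X.card)
    (fun X _ => (determinedBy_not_adj v X).mono (by rintro e ⟨y, -, rfl⟩; simp)) p
    (c := Real.exp (-(p * x))) (Real.exp_pos _).le (fun X hX => by
      rw [measureReal_not_adj p hX.1]
      refine (one_sub_pow_le_exp p _).trans (Real.exp_le_exp.2 ?_)
      exact neg_le_neg (mul_le_mul_of_nonneg_left hX.2 p.2.1))
  refine (measureReal_mono ?_ (measure_ne_top _ _)).trans hmain
  rintro G ⟨⟨hG1, hG2⟩, hlt⟩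
  refine ⟨⟨notMem_ballAround_deleteIncidenceSet G h _, ?_⟩, fun y hy hvy => ?_⟩
  · rw [ballAround_succ]
    refine le_card_closedNbhd_deleteIncidenceSet hc₂ (le_min (by positivity) (by linarith))
      ?_ hG2 (notMem_ballAround_deleteIncidenceSet G h j) ((min_le_left _ _).trans
      (pow_le_card_ballAround_deleteIncidenceSet h hc₁ hG1 j hM₁))
    linarith [min_le_right (c₁ ^ j) (M₂ - 1)]
  · refine absurd hlt (not_lt.2 ?_)
    have h1 : y ∈ ballAround G {s} (j + 1) := by
      refine mem_ballAround_of_edist_le (Finset.mem_singleton_self s) ?_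
      exact (edist_anti (deleteIncidenceSet_le G v)).trans (edist_le_of_mem_ballAround hy)
    have h2 : v ∈ ballAround G {s} (j + 1 + 1) := by
      rw [ballAround_succ, mem_closedNbhd]
      exact Or.inr ⟨y, h1, hvy.symm⟩
    exact edist_le_of_mem_ballAround h2

-- Markov's inequality. Allowing some far pairs gains a factor `m` over excluding all of them, which
-- absorbs the constants lost in the exponent.
open Classical in
theorem measureReal_le_card_far_le (p : unitInterval) {c₁ c₂ M₁ M₂ : ℝ} {j m : ℕ} (hm : 1 ≤ m)
    (hc₁ : 0 ≤ c₁) (hc₂ : 0 ≤ c₂) (hM₁ : ∀ t < j, c₁ ^ t + 1 ≤ M₁) (hM₂ : 1 ≤ M₂) :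
    (binomialRandom V p).real {G | (Expands G c₁ M₁ ∧ Expands G c₂ M₂) ∧
      m ≤ (Finset.univ.filter fun x : V × V => ((j + 2 : ℕ) : ℕ∞) < G.edist x.1 x.2).card} ≤
      (Fintype.card V : ℝ) ^ 2 * Real.exp (-(p * (c₂ * min (c₁ ^ j) (M₂ - 1)))) / m := by
  set A : V × V → Set (SimpleGraph V) := fun x => {G | (Expands G c₁ M₁ ∧ Expands G c₂ M₂) ∧
      ((j + 2 : ℕ) : ℕ∞) < G.edist x.1 x.2} with hA
  have hAle : ∀ x, (binomialRandom V p).real (A x) ≤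
      Real.exp (-(p * (c₂ * min (c₁ ^ j) (M₂ - 1)))) := by
    rintro ⟨s, v⟩
    by_cases h : s = v
    · have : A (s, v) = ∅ := by
        ext G
        simp [hA, h]
      rw [this, measureReal_empty]
      exact (Real.exp_pos _).le
    · exact measureReal_lt_edist_le p h hc₁ hc₂ hM₁ hM₂
  have hmarkov := mul_meas_ge_le_integral_of_nonneg (μ := binomialRandom V p)
    (f := fun G => ∑ x : V × V, (A x).indicator (1 : SimpleGraph V → ℝ) G)
    (ae_of_all _ fun G => Finset.sum_nonneg fun x _ =>
      Set.indicator_nonneg (fun _ _ => zero_le_one) _) Integrable.of_finite (m : ℝ)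
  rw [integral_finsetSum _ (fun T _ => Integrable.of_finite)] at hmarkov
  simp_rw [integral_indicator_one (MeasurableSet.of_discrete)] at hmarkov
  rw [le_div_iff₀ (by exact_mod_cast hm), mul_comm]
  refine le_trans (mul_le_mul_of_nonneg_left (measureReal_mono ?_ (measure_ne_top _ _))
    (by positivity)) (hmarkov.trans ?_)
  · rintro G ⟨hG, hcard⟩
    simp only [Set.mem_ofPred_eq]
    have : ∑ x : V × V, (A x).indicator (1 : SimpleGraph V → ℝ) G =
        (Finset.univ.filter fun x : V × V => ((j + 2 : ℕ) : ℕ∞) < G.edist x.1 x.2).card := by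
      rw [Finset.card_filter]
      simp only [Nat.cast_sum, Nat.cast_ite (R := ℝ), Nat.cast_one, Nat.cast_zero]
      refine Finset.sum_congr rfl fun x _ => ?_
      by_cases h : ((j + 2 : ℕ) : ℕ∞) < G.edist x.1 x.2
      · rw [if_pos h, Set.indicator_of_mem (show G ∈ A x from ⟨hG, h⟩)]; rfl
      · rw [if_neg h, Set.indicator_of_notMem (fun hx : G ∈ A x => h hx.2)]
    rw [this]
    exact_mod_cast hcard
  · calc _ ≤ ∑ x : V × V, Real.exp (-(p * (c₂ * min (c₁ ^ j) (M₂ - 1)))) :=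
        Finset.sum_le_sum fun x _ => hAle x
      _ = _ := by simp [Finset.card_univ, sq]

end SimpleGraph

/-! ### A birthday estimate for non-uniform samples -/

/-- The product depends only on the image of the embedding, and each image arises from at most |α|!
embeddings. -/
theorem sum_embedding_prod_le {α β : Type*} [Fintype α] [Fintype β] [DecidableEq β] (π : β → ℝ)
    (hπ : ∀ b, 0 ≤ π b) :
    ∑ f : α ↪ β, ∏ a, π (f a) ≤ (Fintype.card α).factorial *
      ∑ T ∈ (Finset.univ : Finset β).powersetCard (Fintype.card α), ∏ b ∈ T, π b := by
  classical
  have h1 : ∀ f : α ↪ β, Finset.univ.map f ∈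
      (Finset.univ : Finset β).powersetCard (Fintype.card α) := fun f => by
    simp [Finset.mem_powersetCard, Finset.card_univ]
  rw [← Finset.sum_fiberwise_of_maps_to (fun f _ => h1 f), Finset.mul_sum]
  refine Finset.sum_le_sum fun T hT => ?_
  have h2 : ∀ f ∈ Finset.univ.filter (fun f : α ↪ β => Finset.univ.map f = T),
      ∏ a, π (f a) = ∏ b ∈ T, π b := by
    intro f hf
    rw [← (Finset.mem_filter.1 hf).2, Finset.prod_map]
  rw [Finset.sum_congr rfl h2, Finset.sum_const, nsmul_eq_mul]
  refine mul_le_mul_of_nonneg_right ?_ (Finset.prod_nonneg fun b _ => hπ b)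
  have hcard : Fintype.card (α ↪ T) = (Fintype.card α).factorial := by
    rw [Fintype.card_embedding_eq, Fintype.card_coe, (Finset.mem_powersetCard.1 hT).2,
      Nat.descFactorial_self]
  rw [← hcard]
  norm_cast
  rw [← Fintype.card_coe]
  refine Fintype.card_le_of_injective (fun f => ⟨fun a => ⟨f.1 a, ?_⟩, fun a b hab => ?_⟩) ?_
  · have := (Finset.mem_filter.1 f.2).2
    have h3 : f.1 a ∈ Finset.univ.map f.1 := Finset.mem_map_of_mem _ (Finset.mem_univ a)
    rwa [this] at h3
  · exact f.1.injective (congrArg Subtype.val hab)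
  · intro f g hfg
    ext a
    have := congrArg (fun h : α ↪ T => (h a : β)) hfg
    exact this

/-- With y = x - x²/(2(1 + x)), one has 1 + y + y²/2 = 1 + x + x⁴/(8(1 + x)²). The quadratic saving
becomes the collision probability after summation. -/
theorem Real.one_add_le_exp_sub_sq {x a : ℝ} (hx : 0 ≤ x) (hxa : x ≤ a) :
    1 + x ≤ Real.exp (x - x ^ 2 / (2 * (1 + a))) := by
  have h1 : x ^ 2 / (2 * (1 + a)) ≤ x ^ 2 / (2 * (1 + x)) := by gcongr
  refine le_trans ?_ (Real.exp_le_exp.2 (sub_le_sub_left h1 x))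
  have h2 : x - x ^ 2 / (2 * (1 + x)) = x * (2 + x) / (2 * (1 + x)) := by
    field_simp; ring
  rw [h2]
  refine le_trans ?_ (Real.quadratic_le_exp_of_nonneg (by positivity))
  have h3 : 1 + x * (2 + x) / (2 * (1 + x)) + (x * (2 + x) / (2 * (1 + x))) ^ 2 / 2 - (1 + x) =
      x ^ 4 / (8 * (1 + x) ^ 2) := by
    field_simp; ring
  have : 0 ≤ x ^ 4 / (8 * (1 + x) ^ 2) := by positivity
  linarith

/-- The Stirling sequence is decreasing and starts at e/√2. -/
theorem Real.factorial_le_sqrt_mul_pow {r : ℕ} (hr : 1 ≤ r) :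
    (r.factorial : ℝ) ≤ Real.exp 1 * √r * (r / Real.exp 1) ^ r := by
  obtain ⟨k, rfl⟩ : ∃ k, r = k + 1 := ⟨r - 1, by omega⟩
  have h := Stirling.stirlingSeq'_antitone (Nat.zero_le k)
  simp only [Function.comp_apply, Nat.succ_eq_add_one, zero_add, Stirling.stirlingSeq_one] at h
  unfold Stirling.stirlingSeq at h
  rw [div_le_iff₀ (by positivity)] at h
  refine h.trans (le_of_eq ?_)
  rw [Real.sqrt_mul (by norm_num)]
  field_simp

/-- Upper bound for the probability that independent samples from the distribution `π` are
distinct. -/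
theorem sum_embedding_prod_le_exp {α β : Type*} [Fintype α] [Fintype β] (π : β → ℝ)
    (hπ : ∀ b, 0 ≤ π b) (hsum : ∑ b, π b = 1) {a : ℝ} (ha : ∀ b, π b ≤ a)
    (hα : 1 ≤ Fintype.card α) :
    ∑ f : α ↪ β, ∏ x, π (f x) ≤ Real.exp 1 * √(Fintype.card α) *
      Real.exp (-(Fintype.card α ^ 2 * (∑ b, π b ^ 2) / (2 * (1 + Fintype.card α * a)))) := by
  classical
  refine (sum_embedding_prod_le π hπ).trans ?_
  set r := Fintype.card α with hr
  have hr0 : (0 : ℝ) < r := by exact_mod_cast hα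
  -- The symmetric sum is a part of ∏(1 + rπ(b)). With the scale r the main term e^r cancels the
  -- e^(-r) of r!/r^r, so only a factor of order √r is lost.
  have h1 : (r : ℝ) ^ r * ∑ T ∈ (Finset.univ : Finset β).powersetCard r, ∏ b ∈ T, π b ≤
      Real.exp (r - r ^ 2 * (∑ b, π b ^ 2) / (2 * (1 + r * a))) := by
    calc (r : ℝ) ^ r * ∑ T ∈ (Finset.univ : Finset β).powersetCard r, ∏ b ∈ T, π b
        = ∑ T ∈ (Finset.univ : Finset β).powersetCard r, ∏ b ∈ T, (r * π b) := by
          rw [Finset.mul_sum]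
          refine Finset.sum_congr rfl fun T hT => ?_
          rw [Finset.prod_mul_distrib, Finset.prod_const, (Finset.mem_powersetCard.1 hT).2]
      _ ≤ ∑ T ∈ (Finset.univ : Finset β).powerset, ∏ b ∈ T, (r * π b) := by
          refine Finset.sum_le_sum_of_subset_of_nonneg (fun T _ => by simp) fun T _ _ => ?_
          exact Finset.prod_nonneg fun b _ => mul_nonneg hr0.le (hπ b)
      _ = ∏ b, (1 + r * π b) := (Finset.prod_one_add _).symm
      _ ≤ ∏ b, Real.exp (r * π b - (r * π b) ^ 2 / (2 * (1 + r * a))) := by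
          refine Finset.prod_le_prod (fun b _ => ?_) fun b _ => ?_
          · have := mul_nonneg hr0.le (hπ b); linarith
          · exact Real.one_add_le_exp_sub_sq (mul_nonneg hr0.le (hπ b)) (by gcongr; exact ha b)
      _ = _ := by
          rw [← Real.exp_sum, Finset.sum_sub_distrib, ← Finset.mul_sum, hsum, ← Finset.sum_div]
          simp_rw [mul_pow]
          rw [← Finset.mul_sum, mul_one]
  calc (r.factorial : ℝ) * ∑ T ∈ (Finset.univ : Finset β).powersetCard r, ∏ b ∈ T, π b
      ≤ (Real.exp 1 * √r * (r / Real.exp 1) ^ r) *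
        ∑ T ∈ (Finset.univ : Finset β).powersetCard r, ∏ b ∈ T, π b := by
        refine mul_le_mul_of_nonneg_right (Real.factorial_le_sqrt_mul_pow hα) ?_
        exact Finset.sum_nonneg fun T _ => Finset.prod_nonneg fun b _ => hπ b
    _ = Real.exp 1 * √r * Real.exp (-r) *
        ((r : ℝ) ^ r * ∑ T ∈ (Finset.univ : Finset β).powersetCard r, ∏ b ∈ T, π b) := by
        rw [div_pow, ← Real.exp_nat_mul, mul_one, Real.exp_neg]
        field_simp
    _ ≤ Real.exp 1 * √r * Real.exp (-r) *
        Real.exp (r - r ^ 2 * (∑ b, π b ^ 2) / (2 * (1 + r * a))) := by gcongr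
    _ = _ := by
        rw [mul_assoc _ (Real.exp _), ← Real.exp_add]
        congr 2; ring

namespace SimpleGraph

variable {V : Type*} [Fintype V]

/-- The traces on `S` of the vertices of `Y` are independent samples from one law on subsets of `S`.
Its collision probability is (p² + (1 - p)²)^|S| and, as p ≤ 1/2, no atom exceeds (1 - p)^|S|. -/
theorem measureReal_injOn_le (p : unitInterval) (hp : (p : ℝ) ≤ 1 / 2) {Y S : Finset V}
    (hYS : Disjoint S Y) (hY : 1 ≤ Y.card) :
    (binomialRandom V p).real
      {G | ∀ v ∈ Y, ∀ w ∈ Y, v ≠ w → ¬ ∀ s ∈ S, G.Adj v s ↔ G.Adj w s} ≤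
      Real.exp 1 * √Y.card * Real.exp (-((Y.card : ℝ) ^ 2 * ((p : ℝ) ^ 2 + (1 - p) ^ 2) ^ S.card /
        (2 * (1 + Y.card * (1 - p : ℝ) ^ S.card)))) := by
  classical
  have hp0 := p.2.1
  have hp1 := p.2.2
  set π : S.powerset → ℝ := fun T => (p : ℝ) ^ T.1.card * (1 - p : ℝ) ^ (S.card - T.1.card) with hπ
  have hcover : {G : SimpleGraph V | ∀ v ∈ Y, ∀ w ∈ Y, v ≠ w → ¬ ∀ s ∈ S, G.Adj v s ↔ G.Adj w s} ⊆
      ⋃ f ∈ (Finset.univ : Finset (Y ↪ S.powerset)), ⋂ v ∈ (Finset.univ : Finset Y),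
        {G : SimpleGraph V | ∀ s ∈ S, G.Adj v s ↔ s ∈ (f v).1} := by
    intro G hG
    simp only [Set.mem_iUnion, Set.mem_iInter]
    refine ⟨⟨fun v => ⟨S.filter fun s => G.Adj v s, by simp⟩, fun v w hvw => ?_⟩,
      Finset.mem_univ _, fun v _ s hs => ?_⟩
    · by_contra hne
      refine hG v v.2 w w.2 (fun h => hne (Subtype.ext h)) fun s hs => ?_
      have := congrArg (fun T : S.powerset => s ∈ T.1) hvw
      simpa [hs] using this
    · change G.Adj v s ↔ s ∈ S.filter fun s => G.Adj v s
      simp [hs]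
  have hf : ∀ f : Y ↪ S.powerset, (binomialRandom V p).real (⋂ v ∈ (Finset.univ : Finset Y),
      {G : SimpleGraph V | ∀ s ∈ S, G.Adj v s ↔ s ∈ (f v).1}) = ∏ v : Y, π (f v) := by
    intro f
    rw [measureReal_biInter_of_determinedBy _ (E := fun v : Y => pairsTo (v : V) S)]
    · refine Finset.prod_congr rfl fun v _ => ?_
      exact measureReal_adj_iff_mem p (fun h => Finset.disjoint_left.1 hYS h v.2)
        (Finset.mem_powerset.1 (f v).2)
    · intro v _ G H hGH hG s hs
      have := hGH s((v : V), s) ⟨s, hs, rfl⟩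
      simp only [mem_edgeSet] at this
      rw [← this]
      exact hG s hs
    · intro v _ w _ hvw
      exact pairwiseDisjoint_pairsTo hYS v.2 w.2 (fun h => hvw (Subtype.ext h))
  have hsum : ∀ x y : ℝ, ∑ T : S.powerset, x ^ T.1.card * y ^ (S.card - T.1.card) =
      (x + y) ^ S.card := by
    intro x y
    rw [Finset.sum_coe_sort S.powerset (fun T => x ^ T.card * y ^ (S.card - T.card)),
      Finset.sum_pow_mul_eq_add_pow]
  have hmain := sum_embedding_prod_le_exp (α := Y) π (fun T => by
      have : (0 : ℝ) ≤ 1 - p := by linarith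
      positivity) (by rw [hsum]; ring_nf) (a := (1 - p : ℝ) ^ S.card) (fun T => by
      have hT : T.1.card ≤ S.card := Finset.card_le_card (Finset.mem_powerset.1 T.2)
      calc (p : ℝ) ^ T.1.card * (1 - p : ℝ) ^ (S.card - T.1.card)
          ≤ (1 - p : ℝ) ^ T.1.card * (1 - p : ℝ) ^ (S.card - T.1.card) := by
            have : (0 : ℝ) ≤ 1 - p := by linarith
            gcongr
            linarith
        _ = _ := by rw [← pow_add]; congr 1; omega)
      (by simpa using hY)
  have hsq : ∑ T, π T ^ 2 = ((p : ℝ) ^ 2 + (1 - p) ^ 2) ^ S.card := by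
    rw [← hsum]
    refine Finset.sum_congr rfl fun T _ => ?_
    rw [hπ, mul_pow, ← pow_mul, ← pow_mul, ← pow_mul, ← pow_mul, mul_comm 2, mul_comm 2]
  rw [hsq, Fintype.card_coe] at hmain
  refine ((measureReal_mono hcover (measure_ne_top _ _)).trans
    (measureReal_biUnion_finset_le _ _)).trans ?_
  simp_rw [hf]
  exact hmain

end SimpleGraph

/-! ### Twins in neighbourhoods -/

namespace SimpleGraph

variable {V : Type*} [Fintype V]

/-- The collision probability is at least e^(-2C) and at least (1 - p)^k e^(-C). The first handles
the summand 1 of the denominator, the second the summand r(1 - p)^k. -/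
theorem le_collision_exponent (p : unitInterval) {K k : ℕ} {C r₀ r : ℝ} (hK : (p : ℝ) * K ≤ C)
    (hk : k ≤ K) (hr₀ : 1 ≤ r₀ * Real.exp (-C)) (hr : r₀ ≤ r) (hr0 : 0 ≤ r₀) :
    r₀ * Real.exp (-C) / 4 ≤ r ^ 2 * ((p : ℝ) ^ 2 + (1 - p) ^ 2) ^ k /
        (2 * (1 + r * (1 - p : ℝ) ^ k)) := by
  have hp0 := p.2.1
  have hp1 := p.2.2
  have ha0 : 0 ≤ (1 - p : ℝ) ^ k := pow_nonneg (by linarith) _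
  have hpk : (k : ℝ) * p ≤ C := le_trans (by
    rw [mul_comm]; gcongr) hK
  have h1 : Real.exp (-C) ^ 2 ≤ ((p : ℝ) ^ 2 + (1 - p) ^ 2) ^ k := by
    calc Real.exp (-C) ^ 2 ≤ Real.exp (-(2 * p)) ^ k := by
          rw [← Real.exp_nat_mul, ← Real.exp_nat_mul]
          apply Real.exp_le_exp.2
          push_cast
          linarith
      _ ≤ _ := by
          gcongr
          linarith [Real.exp_neg_le_quadratic (x := 2 * p) (by linarith)]
  have h2 : (1 - p : ℝ) ^ k * Real.exp (-C) ≤ ((p : ℝ) ^ 2 + (1 - p) ^ 2) ^ k := by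
    calc (1 - p : ℝ) ^ k * Real.exp (-C) ≤ (1 - p : ℝ) ^ k * Real.exp (-p) ^ k := by
          gcongr
          rw [← Real.exp_nat_mul]
          apply Real.exp_le_exp.2
          linarith
      _ = ((1 - p : ℝ) * Real.exp (-p)) ^ k := (mul_pow _ _ _).symm
      _ ≤ _ := by
          have hle : (0 : ℝ) ≤ 1 - p := by linarith
          gcongr
          have := Real.exp_neg_le_quadratic hp0
          nlinarith [mul_nonneg hp0 hp0, mul_nonneg (mul_nonneg hp0 hp0) hle]
  have he := Real.exp_pos (-C)
  have hr1 : 0 ≤ r := hr0.trans hr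
  rw [div_le_div_iff₀ (by norm_num) (by positivity)]
  have h3 : r₀ * Real.exp (-C) ≤ r ^ 2 * ((p : ℝ) ^ 2 + (1 - p) ^ 2) ^ k := by
    calc r₀ * Real.exp (-C) ≤ (r₀ * Real.exp (-C)) ^ 2 := by nlinarith
      _ = r₀ ^ 2 * Real.exp (-C) ^ 2 := mul_pow _ _ _
      _ ≤ _ := by gcongr
  have h4 : r₀ * Real.exp (-C) * (r * (1 - p : ℝ) ^ k) ≤
      r ^ 2 * ((p : ℝ) ^ 2 + (1 - p) ^ 2) ^ k := by
    calc r₀ * Real.exp (-C) * (r * (1 - p : ℝ) ^ k)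
        ≤ r * Real.exp (-C) * (r * (1 - p : ℝ) ^ k) := by gcongr
      _ = r ^ 2 * ((1 - p : ℝ) ^ k * Real.exp (-C)) := by ring
      _ ≤ _ := by gcongr
  linarith

open Classical in
/-- The set `S` distinguishes any two neighbours of `u` outside `S`. -/
def NoTwins (G : SimpleGraph V) (S : Finset V) (u : V) : Prop :=
  ∀ v ∈ (Finset.univ.filter (G.Adj u)) \ S, ∀ w ∈ (Finset.univ.filter (G.Adj u)) \ S, v ≠ w →
    ¬ ∀ s ∈ S, G.Adj v s ↔ G.Adj w s

-- Expose the neighbourhood of `u` first; the pairs avoiding `u` are still fresh and drive the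
-- birthday estimate. This is why `u` itself is removed from `S`.
open Classical in
theorem measureReal_noTwins_le (p : unitInterval) (hp : (p : ℝ) ≤ 1 / 2) {K : ℕ} {C r₀ : ℝ}
    (hK : (p : ℝ) * K ≤ C) (hr₀ : 1 ≤ r₀ * Real.exp (-C)) (hr1 : 1 ≤ r₀) {S : Finset V}
    (hS : S.card = K) (u : V) :
    (binomialRandom V p).real {G | r₀ ≤ (((Finset.univ.filter (G.Adj u)) \ S).card : ℝ) ∧
      NoTwins G S u} ≤
      Real.exp 1 * √(Fintype.card V) * Real.exp (-(r₀ * Real.exp (-C) / 4)) := by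
  have hmain := measureReal_exists_le (V := V)
    (F := fun G => Finset.univ.filter (G.Adj u))
    (H := fun Y => {G : SimpleGraph V | ∀ v ∈ Y \ S, ∀ w ∈ Y \ S, v ≠ w →
      ¬ ∀ s ∈ S.erase u, G.Adj v s ↔ G.Adj w s}) (E := {e | u ∈ e}) (E' := {e | u ∉ e})
    (fun Y G H hGH hG => by
      have : Finset.univ.filter (H.Adj u) = Finset.univ.filter (G.Adj u) := by
        ext a
        have := hGH s(u, a) (by simp)
        simpa using this.symm
      simpa [this] using hG)
    (Set.disjoint_left.2 fun e h1 h2 => h2 h1) (fun Y => u ∉ Y ∧ r₀ ≤ ((Y \ S).card : ℝ))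
    (fun Y hY G H hGH hG v hv w hw hvw hs => by
      have hne : ∀ x ∈ Y \ S, ∀ s ∈ S.erase u, G.Adj x s ↔ H.Adj x s := by
        intro x hx s hs
        have hxu : u ≠ x := by
          rintro rfl
          exact hY.1 (Finset.mem_sdiff.1 hx).1
        have := hGH s(x, s) (by simp [hxu, (Finset.ne_of_mem_erase hs).symm])
        simpa using this
      refine hG v hv w hw hvw fun s hsS => ?_
      rw [hne v hv s hsS, hne w hw s hsS]
      exact hs s hsS) p
    (c := Real.exp 1 * √(Fintype.card V) * Real.exp (-(r₀ * Real.exp (-C) / 4)))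
    (by positivity) (fun Y hY => by
      have hpos : 1 ≤ (Y \ S).card := by exact_mod_cast hr1.trans hY.2
      refine (measureReal_injOn_le p hp (S := S.erase u) (Y := Y \ S)
        (Finset.disjoint_left.2 fun x hx hxY =>
          (Finset.mem_sdiff.1 hxY).2 (Finset.mem_of_mem_erase hx)) hpos).trans ?_
      have hcard : ((Y \ S).card : ℝ) ≤ Fintype.card V := by exact_mod_cast Finset.card_le_univ _
      refine mul_le_mul (by gcongr) (Real.exp_le_exp.2 (neg_le_neg ?_)) (Real.exp_pos _).le
        (by positivity)
      exact le_collision_exponent p hK ((Finset.card_erase_le).trans hS.le) hr₀ hY.2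
        (by linarith))
  refine (measureReal_mono ?_ (measure_ne_top _ _)).trans hmain
  rintro G ⟨hr, hG⟩
  refine ⟨⟨by simp, hr⟩, fun v hv w hw hvw hs => hG v hv w hw hvw fun s hsS => ?_⟩
  -- A sensor on `u` cannot distinguish two neighbours of `u`.
  by_cases hsu : s = u
  · subst hsu
    simp only [Finset.mem_sdiff, Finset.mem_filter, Finset.mem_univ, true_and] at hv hw
    exact iff_of_true hv.1.symm hw.1.symm
  · exact hs s (Finset.mem_erase.2 ⟨hsu, hsS⟩)

open Classical in
theorem measureReal_exists_noTwins_le (p : unitInterval) (hp : (p : ℝ) ≤ 1 / 2) {K : ℕ}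
    {C r₀ : ℝ} (hK : (p : ℝ) * K ≤ C) (hr₀ : 1 ≤ r₀ * Real.exp (-C)) (hr1 : 1 ≤ r₀) :
    (binomialRandom V p).real {G | ∃ S : Finset V, S.card = K ∧ ∃ u,
      r₀ ≤ (((Finset.univ.filter (G.Adj u)) \ S).card : ℝ) ∧ NoTwins G S u} ≤
      (Fintype.card V : ℝ) ^ (K + 1) *
        (Real.exp 1 * √(Fintype.card V) * Real.exp (-(r₀ * Real.exp (-C) / 4))) := by
  set P := ((Finset.univ : Finset V).powersetCard K) ×ˢ (Finset.univ : Finset V) with hP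
  have h1 : {G : SimpleGraph V | ∃ S : Finset V, S.card = K ∧ ∃ u,
      r₀ ≤ (((Finset.univ.filter (G.Adj u)) \ S).card : ℝ) ∧ NoTwins G S u} ⊆
      ⋃ x ∈ P, {G | r₀ ≤ (((Finset.univ.filter (G.Adj x.2)) \ x.1).card : ℝ) ∧
        NoTwins G x.1 x.2} := by
    rintro G ⟨S, hS, u, hu⟩
    simp only [Set.mem_iUnion]
    exact ⟨(S, u), by simp [hP, Finset.mem_powersetCard, hS], hu⟩
  calc _ ≤ ∑ x ∈ P, Real.exp 1 * √(Fintype.card V) * Real.exp (-(r₀ * Real.exp (-C) / 4)) := by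
        refine ((measureReal_mono h1 (measure_ne_top _ _)).trans
          (measureReal_biUnion_finset_le _ _)).trans (Finset.sum_le_sum fun x hx => ?_)
        refine measureReal_noTwins_le p hp hK hr₀ hr1 ?_ x.2
        exact (Finset.mem_powersetCard.1 (Finset.mem_product.1 hx).1).2
    _ = P.card * (Real.exp 1 * √(Fintype.card V) * Real.exp (-(r₀ * Real.exp (-C) / 4))) := by
        rw [Finset.sum_const, nsmul_eq_mul]
    _ ≤ _ := by
        gcongr
        rw [hP, Finset.card_product, Finset.card_powersetCard, Finset.card_univ, pow_succ]
        exact_mod_cast Nat.mul_le_mul_right _ (Nat.choose_le_pow _ _)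

/-! ### Collecting the error probabilities -/

/-- Lower bound for the probability that the cops lose, for use when `p` is small. -/
theorem measureReal_not_copsWin_compl_le (p : unitInterval) {ε δ₁ δ₂ M₁ M₂ M c₁ c₂ : ℝ} {j m : ℕ}
    (hε : 0 ≤ ε) (hε2 : ε ≤ 2)
    (hδ₁ : 0 ≤ δ₁) (hδ₁' : δ₁ ≤ 1 / 2) (hM₁ : p * M₁ ≤ δ₁) (hM₁' : M₁ ≤ δ₁ * Fintype.card V / 2)
    (hδ₂ : 0 ≤ δ₂) (hδ₂' : δ₂ ≤ 1 / 2) (hM₂ : p * M₂ ≤ δ₂) (hM₂' : M₂ ≤ δ₂ * Fintype.card V / 2)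
    (hc₁ : c₁ = (1 - 2 * δ₁) * (p * Fintype.card V))
    (hc₂ : c₂ = (1 - 2 * δ₂) * (p * Fintype.card V))
    (hM₁j : ∀ t < j, c₁ ^ t + 1 ≤ M₁) (hM₂1 : 1 ≤ M₂)
    (hm : 1 ≤ m) (hmV : 2 * m ≤ Fintype.card V) (hmM : 3 * m ≤ M / 2)
    (hM : M ≤ (Fintype.card V - 2 * m) * ((1 - p : ℝ) ^ m - (1 - p : ℝ) ^ (2 * m))) :
    (binomialRandom V p).real {G | ∀ k : ℕ,
      k * ((1 + ε) * (p * Fintype.card V) + 1) ^ j ≤ m → ¬ CopsWin G k}ᶜ ≤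
      Fintype.card V * Real.exp (-(ε ^ 2 * (p * Fintype.card V) / 4)) +
      (Real.exp (Fintype.card V * Real.exp (-(δ₁ ^ 2 * (p * Fintype.card V) / 4))) - 1) +
      (Real.exp (Fintype.card V * Real.exp (-(δ₂ ^ 2 * (p * Fintype.card V) / 4))) - 1) +
      (Fintype.card V : ℝ) ^ (2 * m) * Real.exp (-(M / 8)) +
      (Fintype.card V : ℝ) ^ 2 * Real.exp (-(p * (c₂ * min (c₁ ^ j) (M₂ - 1)))) / m := by
  classical
  have hd0 : 0 ≤ p * (Fintype.card V : ℝ) := mul_nonneg p.2.1 (by positivity)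
  have hc₁0 : 0 ≤ c₁ := hc₁ ▸ mul_nonneg (by linarith) hd0
  have hc₂0 : 0 ≤ c₂ := hc₂ ▸ mul_nonneg (by linarith) hd0
  have b1 := measureReal_forall_card_closedNbhd_compl_le (V := V) p hε hε2
  have b2 := measureReal_expands_compl_le (V := V) p hδ₁ hδ₁' hM₁ hM₁'
  have b3 := measureReal_expands_compl_le (V := V) p hδ₂ hδ₂' hM₂ hM₂'
  have b4 := measureReal_exists_disjoint_le (V := V) p (by linarith [(Nat.cast_nonneg m : (0:ℝ) ≤ m)]) hM
  have b5 := measureReal_le_card_far_le (V := V) p (j := j) hm hc₁0 hc₂0 hM₁j hM₂1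
  rw [← hc₁] at b2
  rw [← hc₂] at b3
  refine (measureReal_mono ?_ (measure_ne_top _ _)).trans ((measureReal_union_le _ _).trans
    (add_le_add ((measureReal_union_le _ _).trans (add_le_add ((measureReal_union_le _ _).trans
    (add_le_add ((measureReal_union_le _ _).trans (add_le_add b1 b2)) b3)) b4)) b5))
  intro G hG
  contrapose! hG
  simp only [Set.mem_union, not_or, Set.mem_compl_iff, not_not] at hG
  obtain ⟨⟨⟨⟨h1, h2⟩, h3⟩, h4⟩, h5⟩ := hG
  rw [Set.mem_compl_iff, not_not]
  intro k hk
  refine not_copsWin_of_expansion G hm hmV (by positivity) h1 hk (fun B A hBA hB hA => ?_) ?_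
  · have := h4 B A hBA hB hA
    exact_mod_cast hmM.trans this.le
  · by_contra! hlt
    exact h5 ⟨⟨h2, h3⟩, hlt⟩

/-- Lower bound for the probability that the cops lose, for use when `p` is large. -/
theorem measureReal_not_copsWin_compl_le_of_dense (p : unitInterval) (hp : (p : ℝ) ≤ 1 / 2)
    {δ M C r₀ c : ℝ} {K : ℕ}
    (hδ : 0 ≤ δ) (hδ' : δ ≤ 1 / 2) (hM : p * M ≤ δ) (hM' : M ≤ δ * Fintype.card V / 2)
    (hM2 : 2 ≤ M) (hc : c = (1 - 2 * δ) * (p * Fintype.card V))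
    (hK : (p : ℝ) * K ≤ C) (hr₀ : 1 ≤ r₀ * Real.exp (-C)) (hr1 : 1 ≤ r₀) (hcr : r₀ + K ≤ c)
    (hKV : K ≤ Fintype.card V) (hV : 2 ≤ Fintype.card V) :
    (binomialRandom V p).real {G | ∀ k : ℕ, k ≤ K → ¬ CopsWin G k}ᶜ ≤
      (Real.exp (Fintype.card V * Real.exp (-(δ ^ 2 * (p * Fintype.card V) / 4))) - 1) +
      (Fintype.card V : ℝ) ^ (K + 1) *
        (Real.exp 1 * √(Fintype.card V) * Real.exp (-(r₀ * Real.exp (-C) / 4))) +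
      (Fintype.card V : ℝ) ^ 2 * Real.exp (-(p * c)) := by
  classical
  have hd0 : 0 ≤ p * (Fintype.card V : ℝ) := mul_nonneg p.2.1 (by positivity)
  have hc0 : 0 ≤ c := hc ▸ mul_nonneg (by linarith) hd0
  have b1 := measureReal_expands_compl_le (V := V) p hδ hδ' hM hM'
  have b2 := measureReal_exists_noTwins_le (V := V) p hp hK hr₀ hr1
  -- With `j = 0` and `m = 1` this bounds the probability that the diameter exceeds two. The first
  -- expansion property is void (`c₁ = 0`), and `c₁ ^ 0 = 1` counts the starting vertex.
  have b3 := measureReal_le_card_far_le (V := V) p (j := 0) (M₁ := 0) (M₂ := M) (m := 1) le_rfl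
    le_rfl hc0 (by simp) (by linarith)
  rw [pow_zero, min_eq_left (by linarith), mul_one, Nat.cast_one, div_one] at b3
  rw [← hc] at b1
  refine (measureReal_mono ?_ (measure_ne_top _ _)).trans ((measureReal_union_le _ _).trans
    (add_le_add ((measureReal_union_le _ _).trans (add_le_add b1 b2)) b3))
  intro G hG
  contrapose! hG
  simp only [Set.mem_union, not_or, Set.mem_compl_iff, not_not] at hG
  obtain ⟨⟨h1, h2⟩, h3⟩ := hG
  rw [Set.mem_compl_iff, not_not]
  intro k hk
  refine not_copsWin_of_twins G hk hKV hV (fun s v => ?_) fun S hS u => ?_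
  · by_contra! hlt
    refine h3 ⟨⟨fun X _ => by simp, h1⟩, Finset.card_pos.2 ⟨(s, v), ?_⟩⟩
    simpa using hlt
  · by_contra! hno
    refine h2 ⟨S, hS, u, ?_, fun v hv w hw hvw hs => ?_⟩
    · have hdeg := h1 {u} (by simp; linarith)
      have hb : boundaryCard G {u} ≤ (Finset.univ.filter (G.Adj u)).card := by
        refine Finset.card_le_card fun v hv => ?_
        simp only [Finset.mem_filter, Finset.mem_singleton, exists_eq_left] at hv
        simpa using hv.2.symm
      have hsd := Finset.le_card_sdiff S (Finset.univ.filter (G.Adj u))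
      have h6 : (((Finset.univ.filter (G.Adj u)).card : ℕ) : ℝ) ≤
          (((Finset.univ.filter (G.Adj u)) \ S).card : ℝ) + K := by
        rw [← hS]
        exact_mod_cast (by omega)
      have h7 : (boundaryCard G {u} : ℝ) ≤ ((Finset.univ.filter (G.Adj u)).card : ℝ) := by
        exact_mod_cast hb
      simp only [Finset.card_singleton, Nat.cast_one, mul_one] at hdeg
      linarith
    · simp only [Finset.mem_sdiff, Finset.mem_filter, Finset.mem_univ, true_and] at hv hw
      obtain ⟨s, hsS, hs'⟩ := hno v w hvw hv.1 hw.1 hv.2 hw.2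
      have := hs s hsS
      tauto

end SimpleGraph

/-! ### Numerical estimates -/

theorem Real.exp_mul_exp_neg_sub_one_le {L y : ℝ} (hL : 0 ≤ L) (hy : 2 * L ≤ y) :
    Real.exp (Real.exp L * Real.exp (-y)) - 1 ≤ 2 * Real.exp (-L) := by
  rw [← Real.exp_add]
  have h1 : Real.exp (L + -y) ≤ Real.exp (-L) := Real.exp_le_exp.2 (by linarith)
  have h2 : Real.exp (-L) ≤ 1 := Real.exp_le_one_iff.2 (by linarith)
  have h3 := Real.exp_pos (L + -y)
  have := Real.abs_exp_sub_one_le (x := Real.exp (L + -y)) (by rw [abs_of_pos h3]; linarith)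
  rw [abs_of_pos h3] at this
  linarith [(abs_le.1 this).2]

theorem Real.exp_neg_le_one_div {L : ℝ} (hL : 0 < L) : Real.exp (-L) ≤ 1 / L := by
  rw [Real.exp_neg, ← one_div]
  gcongr
  linarith [Real.add_one_le_exp L]

/-- This bounds (1 - p)^m below by exp(-pm - p²m), which is of order e^(-pm) as long as p²m is
bounded. -/
theorem Real.exp_neg_add_sq_le_one_sub {p : ℝ} (hp0 : 0 ≤ p) (hp : p ≤ 1 / 3) :
    Real.exp (-(p + p ^ 2)) ≤ 1 - p := by
  have h := Real.quadratic_le_exp_of_nonneg (x := p + p ^ 2) (by positivity)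
  rw [Real.exp_neg]
  refine inv_le_of_inv_le₀ (by linarith) (le_trans ?_ h)
  rw [inv_le_iff_one_le_mul₀ (by linarith)]
  have : (1 + (p + p ^ 2) + (p + p ^ 2) ^ 2 / 2) * (1 - p) =
      1 + p ^ 2 * (1 - p - p ^ 2 - p ^ 3) / 2 := by ring
  rw [this]
  have h2 : p ^ 2 ≤ 1 / 3 := by nlinarith
  have h3 : p ^ 3 ≤ 1 / 3 := by nlinarith [sq_nonneg p]
  have : 0 ≤ p ^ 2 * (1 - p - p ^ 2 - p ^ 3) := mul_nonneg (sq_nonneg p) (by linarith)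
  linarith

namespace SimpleGraph

/-- Consequences of `log n` being large and `log d > 3 log log n`, where `L = log n`. -/
theorem log_facts {L d : ℝ} (hL : 160 * Real.exp 58 ≤ L) (hd0 : 0 < d)
    (hC : 3 * Real.log L < Real.log d) : 9440 ≤ L ∧ 174 ≤ Real.log d ∧ L ^ 3 < d := by
  have h1 : 9440 ≤ L := by linarith [Real.add_one_le_exp (58 : ℝ)]
  have h2 : 58 ≤ Real.log L := by
    rw [Real.le_log_iff_exp_le (by linarith)]
    linarith [Real.exp_pos 58]
  refine ⟨h1, by linarith, ?_⟩
  rw [← Real.log_lt_log_iff (by positivity) hd0, Real.log_pow]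
  exact_mod_cast hC

theorem mul_log_le {L d : ℝ} {i : ℕ} (hL : 1 ≤ L) (hd0 : 0 < d)
    (hdi : d ^ i ≤ Real.exp L * L) : i * Real.log d ≤ 2 * L := by
  have h := Real.log_le_log (by positivity) hdi
  rw [Real.log_pow, Real.log_mul (Real.exp_pos L).ne' (by linarith), Real.log_exp] at h
  linarith [Real.log_le_sub_one_of_pos (show 0 < L by linarith)]

/-- The relative degree error 6/L accumulates over `j` steps to a factor at most exp(12/log d) ≤ 1 +
24/log d. As C ≤ log d, this adds only a constant to C. -/
theorem mul_pow_le_of_lt {L d N k : ℝ} {j : ℕ} (hL : 9440 ≤ L) (hlogd : 174 ≤ Real.log d)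
    (hd0 : 0 < d) (hdL : L ^ 3 < d) (hN : 0 < N) (hC : 0 < Real.log d - 3 * Real.log L)
    (hij : ((j + 1 : ℕ) : ℝ) * Real.log d ≤ 2 * L)
    (hk : k < (Real.log d - 3 * Real.log L) * (N / d ^ (j + 1))) :
    k * ((1 + 5 / L) * d + 1) ^ j ≤ (Real.log d - 3 * Real.log L + 25) * (N / d) := by
  set C := Real.log d - 3 * Real.log L with hCdef
  have hL0 : 0 < L := by linarith
  have hlogL : 0 ≤ Real.log L := Real.log_nonneg (by linarith)
  have hD : (1 + 5 / L) * d + 1 ≤ d * Real.exp (6 / L) := by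
    have h1 : 1 ≤ d / L := by
      rw [le_div_iff₀ hL0]
      nlinarith [sq_nonneg L, mul_pos hL0 hL0]
    have h2 : 6 / L + 1 ≤ Real.exp (6 / L) := Real.add_one_le_exp _
    calc (1 + 5 / L) * d + 1 ≤ (1 + 5 / L) * d + d / L := by linarith
      _ = d * (6 / L + 1) := by ring
      _ ≤ _ := by gcongr
  have hj : (j : ℝ) * (6 / L) ≤ 12 / Real.log d := by
    rw [le_div_iff₀ (by linarith)]
    push_cast at hij
    have : (j : ℝ) * (6 / L) * Real.log d = 6 * (j * Real.log d) / L := by ring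
    rw [this, div_le_iff₀ hL0]
    linarith
  have hu : 12 / Real.log d ≤ 1 := by
    rw [div_le_one (by linarith)]; linarith
  have hexp : Real.exp (12 / Real.log d) ≤ 1 + 2 * (12 / Real.log d) := by
    have h0 : 0 ≤ 12 / Real.log d := by positivity
    have := Real.abs_exp_sub_one_le (x := 12 / Real.log d) (by rw [abs_of_nonneg h0]; exact hu)
    rw [abs_of_nonneg h0] at this
    linarith [(abs_le.1 this).2]
  have hCe : C * Real.exp (12 / Real.log d) ≤ C + 25 := by
    calc C * Real.exp (12 / Real.log d) ≤ C * (1 + 2 * (12 / Real.log d)) := by gcongr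
      _ = C + 24 * (C / Real.log d) := by ring
      _ ≤ C + 24 * 1 := by
          gcongr
          rw [div_le_one (by linarith)]
          linarith
      _ ≤ _ := by linarith
  calc k * ((1 + 5 / L) * d + 1) ^ j
      ≤ (C * (N / d ^ (j + 1))) * (d * Real.exp (6 / L)) ^ j := by gcongr
    _ = C * Real.exp (j * (6 / L)) * (N / d) := by
        rw [mul_pow, ← Real.exp_nat_mul, pow_succ]
        field_simp
    _ ≤ C * Real.exp (12 / Real.log d) * (N / d) := by gcongr
    _ ≤ _ := by gcongr

/-- The factor N·d bounds N²/m. The expansion losses leave at least 0.81 of d^(j+2)/N in the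
exponent, and the cap on set sizes leaves at least 3L. -/
theorem le_expansion_exponent {L d N : ℝ} {j : ℕ} (hL : 9440 ≤ L)
    (hN : N = Real.exp L) (hlogd : 174 ≤ Real.log d) (hd0 : 0 < d) (hdL : L ^ 3 < d)
    (hij : ((j + 1 : ℕ) : ℝ) * Real.log d ≤ 2 * L) (hdN : 40 * d ≤ N)
    (hdj : 2 * L ≤ d ^ (j + 2) / N) :
    N * d * Real.exp (-(d / N * ((1 - 2 * (1 / 20)) * d *
      min (((1 - 2 * (3 / L)) * d) ^ j) (N / (20 * d) - 1)))) ≤ 1 / L := by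
  have hL0 : 0 < L := by linarith
  have hN0 : 0 < N := hN ▸ Real.exp_pos L
  have hj : (j : ℝ) * (6 / L) ≤ 1 / 10 := by
    push_cast at hij
    have h1 : (j : ℝ) * 174 ≤ 2 * L := by nlinarith [(Nat.cast_nonneg j : (0 : ℝ) ≤ j)]
    have : (j : ℝ) * (6 / L) = 6 * j / L := by ring
    rw [this, div_le_iff₀ hL0]
    linarith
  have hbern : 9 / 10 ≤ (1 - 2 * (3 / L)) ^ j := by
    have h6 : 6 / L ≤ 1 := by rw [div_le_one hL0]; linarith
    have := one_add_mul_le_pow (a := -(6 / L)) (by linarith) j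
    calc (9 / 10 : ℝ) ≤ 1 + j * -(6 / L) := by linarith
      _ ≤ (1 + -(6 / L)) ^ j := this
      _ = _ := by congr 1; ring
  have ha : 81 / 100 * (d ^ (j + 2) / N) ≤
      d / N * ((1 - 2 * (1 / 20)) * d * ((1 - 2 * (3 / L)) * d) ^ j) := by
    calc 81 / 100 * (d ^ (j + 2) / N) = 9 / 10 * (9 / 10) * (d ^ (j + 2) / N) := by norm_num
      _ ≤ 9 / 10 * (1 - 2 * (3 / L)) ^ j * (d ^ (j + 2) / N) := by gcongr
      _ = _ := by rw [mul_pow, pow_add]; ring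
  have hb : 3 * L ≤ d / N * ((1 - 2 * (1 / 20)) * d * (N / (20 * d) - 1)) := by
    have h1 : N / (40 * d) ≤ N / (20 * d) - 1 := by
      have : N / (20 * d) = 2 * (N / (40 * d)) := by field_simp; norm_num
      rw [this]
      have : 1 ≤ N / (40 * d) := by rw [le_div_iff₀ (by positivity)]; linarith
      linarith
    calc 3 * L ≤ 9 / 400 * d := by nlinarith [mul_pos hL0 hL0]
      _ = d / N * ((1 - 2 * (1 / 20)) * d * (N / (40 * d))) := by field_simp; norm_num
      _ ≤ _ := by
        have : (0 : ℝ) ≤ 1 - 2 * (1 / 20) := by norm_num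
        gcongr
  have hmin : d / N * ((1 - 2 * (1 / 20)) * d * min (((1 - 2 * (3 / L)) * d) ^ j)
      (N / (20 * d) - 1)) = min (d / N * ((1 - 2 * (1 / 20)) * d * ((1 - 2 * (3 / L)) * d) ^ j))
      (d / N * ((1 - 2 * (1 / 20)) * d * (N / (20 * d) - 1))) := by
    rw [mul_min_of_nonneg _ _ (by nlinarith), mul_min_of_nonneg _ _ (by positivity)]
  rw [hmin]
  have hsmall : ∀ z, z ≤ -(L / 20) → Real.exp z ≤ 1 / L := by
    intro z hz
    refine (Real.exp_le_exp.2 hz).trans ?_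
    rw [Real.exp_neg, ← one_div]
    gcongr
    refine le_trans ?_ (Real.quadratic_le_exp_of_nonneg (by positivity))
    nlinarith
  have hdexp : d = Real.exp (Real.log d) := (Real.exp_log hd0).symm
  -- For smaller d the exponent 1.6 L beats L + log d ≤ 1.55 L. For larger d already d²/N is a power
  -- of N, so the exponent is at least 3L, against L + log d ≤ 2L.
  by_cases hcase : Real.log d ≤ 11 / 20 * L
  · refine le_trans (b := Real.exp (L + Real.log d + -(8 / 5 * L))) ?_ (hsmall _ (by linarith))
    rw [Real.exp_add, Real.exp_add, ← hN, ← hdexp]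
    gcongr
    exact le_min (by linarith) (by linarith)
  · push Not at hcase
    have hd2 : Real.exp (L / 10) ≤ d ^ (j + 2) / N := by
      rw [le_div_iff₀ hN0, hN, ← Real.exp_add]
      calc Real.exp (L / 10 + L) ≤ Real.exp (2 * Real.log d) := Real.exp_le_exp.2 (by linarith)
        _ = d ^ 2 := by rw [two_mul, Real.exp_add, ← hdexp]; ring
        _ ≤ d ^ (j + 2) := pow_le_pow_right₀ (by nlinarith [mul_pos hL0 hL0]) (by omega)
    have hq := Real.quadratic_le_exp_of_nonneg (x := L / 10) (by positivity)
    have hlogdL : Real.log d ≤ L := by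
      have := Real.log_le_log hd0 (show d ≤ N by linarith)
      rwa [hN, Real.log_exp] at this
    refine le_trans (b := Real.exp (L + Real.log d + -(3 * L))) ?_ (hsmall _ (by linarith))
    rw [Real.exp_add, Real.exp_add, ← hN, ← hdexp]
    gcongr
    refine le_min ?_ hb
    nlinarith

end SimpleGraph

/-! ### The sparse and the dense regime -/

namespace SimpleGraph

theorem exp_neg_log_sub {L d : ℝ} (hL0 : 0 < L) (hd0 : 0 < d) :
    Real.exp (-(Real.log d - 3 * Real.log L)) = L ^ 3 / d := by
  rw [neg_sub, Real.exp_sub, Real.exp_log hd0, mul_comm 3, Real.exp_mul, Real.exp_log hL0]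
  norm_cast

theorem pow_three_facts {L d : ℝ} (hL : 9440 ≤ L) (hdL : L ^ 3 < d) :
    L * 9440 ≤ L ^ 2 ∧ L ^ 2 * 9440 ≤ L ^ 3 ∧ 9440 * L ≤ d := by
  have h1 : L * 9440 ≤ L ^ 2 := by nlinarith
  have h2 : L ^ 2 * 9440 ≤ L ^ 3 := by nlinarith [sq_nonneg L]
  exact ⟨h1, h2, by linarith⟩

theorem exp_expands_bound_le {L y : ℝ} (hL : 0 < L) (hy : 2 * L ≤ y) :
    Real.exp (Real.exp L * Real.exp (-y)) - 1 ≤ 2 / L := by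
  refine (Real.exp_mul_exp_neg_sub_one_le hL.le hy).trans ?_
  rw [div_eq_mul_one_div]
  have := Real.exp_neg_le_one_div hL
  gcongr

theorem le_degree_exponents {L d : ℝ} (hL : 9440 ≤ L) (hdL : L ^ 3 < d) :
    2 * L ≤ (5 / L) ^ 2 * d / 4 ∧ 2 * L ≤ (3 / L) ^ 2 * d / 4 ∧ 2 * L ≤ (1 / 20) ^ 2 * d / 4 := by
  have hL0 : 0 < L := by linarith
  obtain ⟨-, -, h3⟩ := pow_three_facts hL hdL
  have h4 : L ≤ d / L ^ 2 := by
    rw [le_div_iff₀ (by positivity)]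
    linarith
  have h5 : ∀ a : ℝ, (a / L) ^ 2 * d / 4 = a ^ 2 / 4 * (d / L ^ 2) := fun a => by
    rw [div_pow]; ring
  rw [h5, h5]
  refine ⟨by linarith, by linarith, by linarith⟩

/-- The choice of the size `m` of the sets of vertices in the sparse case. -/
theorem exists_expansion_parameters {p N L d C : ℝ} (hL : 160 * Real.exp 58 ≤ L) (hL1 : 9440 ≤ L)
    (hd0 : 0 < d) (hN0 : 0 < N) (hdL : L ^ 3 < d) (hpd : p = d / N) (hpL : p * L ≤ 16)
    (hC0 : 0 < C) (hCL : C ≤ L) (hexpC : Real.exp (-C) = L ^ 3 / d) :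
    ∃ (m : ℕ) (M : ℝ), 1 ≤ m ∧ (C + 25) * (N / d) ≤ m ∧ m ≤ 2 * L * (N / d) ∧ m ≤ N / 4 ∧
      40 * (L ^ 2 * (N / d)) ≤ M ∧
      M ≤ (N - 2 * m) * ((1 - p : ℝ) ^ m - (1 - p : ℝ) ^ (2 * m)) := by
  obtain ⟨hL12, hL2, hdL1⟩ := pow_three_facts hL1 hdL
  have hL0 : 0 < L := by linarith
  have hp0 : 0 ≤ p := by rw [hpd]; positivity
  have hdN : d * L ≤ 16 * N := by
    rwa [hpd, div_mul_eq_mul_div, div_le_iff₀ hN0] at hpL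
  have hdN40 : 40 * d ≤ N := by nlinarith
  have hNd : 40 ≤ N / d := by rw [le_div_iff₀ hd0]; exact hdN40
  have hNd0 : 0 < N / d := by positivity
  -- Here 58 = 26 + 32, from pm ≤ C + 26 and p²m ≤ 32. The divisor 4 pays for N - 2m ≥ N/2 and for a
  -- - a² ≥ a/2, where a = (1 - p)^m.
  refine ⟨⌈(C + 25) * (N / d)⌉₊, Real.exp (-58) * (L ^ 3 / d) * N / 4, ?_⟩
  have hm1 : (C + 25) * (N / d) ≤ ⌈(C + 25) * (N / d)⌉₊ := Nat.le_ceil _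
  have hmlt := Nat.ceil_lt_add_one (show 0 ≤ (C + 25) * (N / d) by positivity)
  generalize ⌈(C + 25) * (N / d)⌉₊ = m at hm1 hmlt ⊢
  have hm2 : (m : ℝ) ≤ (C + 26) * (N / d) := by linarith
  have hm2L : (m : ℝ) ≤ 2 * L * (N / d) := hm2.trans (by gcongr; linarith)
  have hm3 : (m : ℝ) ≤ N / 4 := by
    refine hm2L.trans ?_
    rw [mul_div_assoc', div_le_iff₀ hd0]
    nlinarith
  have hmpos : 1 ≤ m := by
    have : (0 : ℝ) < m := lt_of_lt_of_le (by positivity) hm1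
    exact_mod_cast this
  have hp3 : p ≤ 1 / 3 := by
    rw [hpd, div_le_iff₀ hN0]; linarith
  have hpm1 : p * m ≤ C + 26 := by
    calc p * m ≤ d / N * ((C + 26) * (N / d)) := by rw [hpd]; gcongr
      _ = _ := by field_simp
  have hpm2 : 1 ≤ p * m := by
    calc (1 : ℝ) ≤ C + 25 := by linarith
      _ = d / N * ((C + 25) * (N / d)) := by field_simp
      _ ≤ p * m := by rw [hpd]; gcongr
  have hp2m : p ^ 2 * m ≤ 32 := by
    calc p ^ 2 * m = p * (p * m) := by ring
      _ ≤ p * (2 * L) := mul_le_mul_of_nonneg_left (by linarith) hp0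
      _ ≤ 32 := by linarith
  have ha1 : Real.exp (-58) * (L ^ 3 / d) ≤ (1 - p) ^ m := by
    calc Real.exp (-58) * (L ^ 3 / d) = Real.exp (-58 + -C) := by rw [Real.exp_add, hexpC]
      _ ≤ Real.exp (m * -(p + p ^ 2)) := Real.exp_le_exp.2 (by linarith)
      _ = Real.exp (-(p + p ^ 2)) ^ m := Real.exp_nat_mul _ _
      _ ≤ _ := by gcongr; exact Real.exp_neg_add_sq_le_one_sub hp0 hp3
  have ha2 : (1 - p) ^ m ≤ 1 / 2 := by
    calc (1 - p) ^ m ≤ Real.exp (-p) ^ m := by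
          gcongr
          · linarith
          · linarith [Real.add_one_le_exp (-p)]
      _ = Real.exp (-(p * m)) := by rw [← Real.exp_nat_mul]; congr 1; ring
      _ ≤ Real.exp (-1) := Real.exp_le_exp.2 (neg_le_neg hpm2)
      _ ≤ _ := by
        have := Real.exp_neg_le_quadratic (zero_le_one (α := ℝ))
        linarith
  refine ⟨hmpos, hm1, hm2L, hm3, ?_, ?_⟩
  · have h58 : 160 ≤ Real.exp (-58) * L := by
      rw [Real.exp_neg, inv_mul_eq_div, le_div_iff₀ (Real.exp_pos _)]; exact hL
    calc 40 * (L ^ 2 * (N / d)) = 160 * (L ^ 2 * (N / d) / 4) := by ring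
      _ ≤ Real.exp (-58) * L * (L ^ 2 * (N / d) / 4) := by gcongr
      _ = _ := by ring
  · rw [two_mul m, pow_add]
    have h0 : 0 ≤ Real.exp (-58) * (L ^ 3 / d) := by positivity
    generalize Real.exp (-58) * (L ^ 3 / d) = b at ha1 h0
    generalize (1 - p) ^ m = a at ha1 ha2
    calc b * N / 4 = (N / 2) * (b / 2) := by ring
      _ ≤ (N - 2 * m) * (a - a * a) := by
          refine mul_le_mul (by linarith) (by nlinarith) (by positivity) (by linarith)

/-- As d^t ≤ d^(j+1)/d² ≤ NL/d² and d > L³, the sets met before the last step are small enough for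
the sharp expansion rate. -/
theorem pow_add_one_le_of_lt {L d N : ℝ} {j t : ℕ} (hL : 9440 ≤ L) (hd0 : 0 < d) (hN0 : 0 < N)
    (hdL : L ^ 3 < d) (hdi : d ^ (j + 1) ≤ N * L) (ht : t < j) :
    ((1 - 2 * (3 / L)) * d) ^ t + 1 ≤ 3 / L * (N / d) := by
  obtain ⟨hL12, hL2, hdL1⟩ := pow_three_facts hL hdL
  have hL0 : 0 < L := by linarith
  obtain ⟨j, rfl⟩ : ∃ l, j = l + 1 := ⟨j - 1, by omega⟩
  have hd1 : 1 ≤ d := by linarith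
  have h6 : 2 * (3 / L) ≤ 1 := by rw [← mul_div_assoc, div_le_iff₀ hL0]; linarith
  have h1 : ((1 - 2 * (3 / L)) * d) ^ t ≤ d ^ j := by
    calc ((1 - 2 * (3 / L)) * d) ^ t ≤ d ^ t := by
          refine pow_le_pow_left₀ (mul_nonneg (by linarith) hd0.le) ?_ t
          exact mul_le_of_le_one_left hd0.le (by linarith [show 0 ≤ 3 / L by positivity])
      _ ≤ d ^ j := pow_le_pow_right₀ hd1 (by omega)
  have h2 : d ^ j * d ^ 2 ≤ N * L := by rw [← pow_add]; exact hdi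
  have h3 : 1 ≤ d ^ j := one_le_pow₀ hd1
  have h4 : d ^ j ≤ 1 / L * (N / d) := by
    rw [div_mul_div_comm, one_mul, le_div_iff₀ (by positivity)]
    have h5 : L ^ 2 * (d ^ j * d) ≤ N * L := by
      refine le_trans ?_ h2
      calc L ^ 2 * (d ^ j * d) ≤ d * (d ^ j * d) := by
            gcongr
            linarith
        _ = _ := by ring
    have h7 : L * (d ^ j * (L * d)) ≤ L * N := by linarith
    exact le_of_mul_le_mul_left h7 hL0
  calc _ ≤ d ^ j + d ^ j := add_le_add h1 h3
    _ ≤ 3 * (1 / L * (N / d)) := by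
      have : 0 ≤ 1 / L * (N / d) := by positivity
      linarith
    _ = _ := by ring

theorem measureReal_not_copsWin_compl_le_of_sparse {n : ℕ} (p : unitInterval) {L d : ℝ} {j : ℕ}
    (hn : (n : ℝ) = Real.exp L) (hL : 160 * Real.exp 58 ≤ L) (hd : d = p * n) (hd0 : 0 < d)
    (hC : 3 * Real.log L < Real.log d) (hdi : d ^ (j + 1) ≤ n * L)
    (hdj : 2 * L ≤ d ^ (j + 2) / n) (hdN40 : 40 * d ≤ n) (hpL : p * L ≤ 16) :
    (binomialRandom (Fin n) p).real {G | ∀ k : ℕ,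
      (k : ℝ) < (Real.log d - 3 * Real.log L) * (n / d ^ (j + 1)) → ¬ CopsWin G k}ᶜ ≤ 7 / L := by
  obtain ⟨hL1, hlogd, hdL⟩ := log_facts hL hd0 hC
  have hij := mul_log_le (L := L) (by linarith) hd0 (by rwa [hn] at hdi)
  obtain ⟨hL12, hL2, hdL1⟩ := pow_three_facts hL1 hdL
  have hL0 : 0 < L := by linarith
  obtain ⟨N, hN⟩ : ∃ N : ℝ, N = n := ⟨_, rfl⟩
  have hcard : ((Fintype.card (Fin n) : ℕ) : ℝ) = N := by rw [Fintype.card_fin, hN]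
  rw [← hN] at hn hd hdi hdj hdN40 ⊢
  have hn0 : 0 < N := hn ▸ Real.exp_pos L
  have hpd : (p : ℝ) = d / N := by rw [hd]; field_simp
  have hlogL : 0 ≤ Real.log L := Real.log_nonneg (by linarith)
  have hlogdL : Real.log d ≤ L := by
    have := Real.log_le_log hd0 (show d ≤ N by linarith)
    rwa [hn, Real.log_exp] at this
  have hNd0 : 0 < N / d := by positivity
  obtain ⟨m, M, hmpos, hm1, hm2, hm3, hM1, hM2⟩ := exists_expansion_parameters hL hL1 hd0 hn0 hdL
    hpd hpL (sub_pos.2 hC) (by linarith) (exp_neg_log_sub hL0 hd0)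
  have hLNd : L * 9440 * (N / d) ≤ L ^ 2 * (N / d) := by gcongr
  -- Errors repeated in up to `j` steps must be O(1/L); the last expansion step occurs once, so the
  -- constant loss 1/20 is affordable and buys larger sets.
  have key := measureReal_not_copsWin_compl_le (V := Fin n) p (ε := 5 / L) (δ₁ := 3 / L)
    (δ₂ := 1 / 20) (M₁ := 3 / L * (N / d)) (M₂ := N / (20 * d)) (M := M) (j := j) (m := m)
    (c₁ := (1 - 2 * (3 / L)) * d) (c₂ := (1 - 2 * (1 / 20)) * d)
    (by positivity) (by rw [div_le_iff₀ hL0]; linarith) (by positivity)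
    (by rw [div_le_iff₀ hL0]; linarith) (by rw [hpd]; field_simp; rfl)
    (by
      rw [hcard, mul_div_assoc]
      gcongr
      linarith) (by norm_num) (by norm_num) (by rw [hpd]; field_simp; norm_num)
    (by
      rw [hcard, div_le_iff₀ (by positivity)]
      nlinarith [mul_le_mul_of_nonneg_left (show 1 ≤ d by linarith) hn0.le])
    (by rw [hcard, hd]) (by rw [hcard, hd])
    (fun t ht => pow_add_one_le_of_lt hL1 hd0 hn0 hdL hdi ht)
    (by
      rw [le_div_iff₀ (by positivity)]
      linarith) hmpos (by
      rw [Fintype.card_fin]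
      have : ((2 * m : ℕ) : ℝ) ≤ n := by push_cast; rw [← hN]; linarith
      exact_mod_cast this)
    (by linarith) (by rw [hcard]; exact hM2)
  rw [hcard, ← hd] at key
  refine (measureReal_mono ?_ (measure_ne_top _ _)).trans (key.trans ?_)
  · refine Set.compl_subset_compl.2 fun G hG k hk => hG k ?_
    exact (mul_pow_le_of_lt hL1 hlogd hd0 hdL hn0 (sub_pos.2 hC) hij hk).trans hm1
  · have hexp1 := Real.exp_neg_le_one_div hL0
    obtain ⟨e1, e2, e3⟩ := le_degree_exponents hL1 hdL
    have t1 : N * Real.exp (-((5 / L) ^ 2 * d / 4)) ≤ 1 / L := by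
      refine le_trans ?_ hexp1
      rw [hn, ← Real.exp_add]
      exact Real.exp_le_exp.2 (by linarith)
    have t2 : Real.exp (N * Real.exp (-((3 / L) ^ 2 * d / 4))) - 1 ≤ 2 / L := by
      rw [hn]; exact exp_expands_bound_le hL0 e2
    have t3 : Real.exp (N * Real.exp (-((1 / 20) ^ 2 * d / 4))) - 1 ≤ 2 / L := by
      rw [hn]; exact exp_expands_bound_le hL0 e3
    -- The pairs of sets cost at most 4L²N/d in the exponent, while M/8 is at least 5L²N/d.
    have t4 : N ^ (2 * m) * Real.exp (-(M / 8)) ≤ 1 / L := by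
      refine le_trans ?_ hexp1
      rw [hn, ← Real.exp_nat_mul, ← Real.exp_add]
      apply Real.exp_le_exp.2
      push_cast
      have h1 : 2 * m * L ≤ 4 * (L ^ 2 * (N / d)) := by
        calc 2 * m * L ≤ 2 * (2 * L * (N / d)) * L := by gcongr
          _ = _ := by ring
      have h2 : L ≤ L * 9440 * (N / d) := by
        have : 1 ≤ N / d := by rw [le_div_iff₀ hd0]; linarith
        nlinarith
      linarith
    have t5 : N ^ 2 * Real.exp (-(p * ((1 - 2 * (1 / 20)) * d *
        min (((1 - 2 * (3 / L)) * d) ^ j) (N / (20 * d) - 1)))) / m ≤ 1 / L := by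
      refine le_trans ?_ (le_expansion_exponent hL1 hn hlogd hd0 hdL hij hdN40 hdj)
      rw [hpd, div_le_iff₀ (by exact_mod_cast hmpos)]
      have : N ≤ d * m := by
        calc N = d * (1 * (N / d)) := by field_simp
          _ ≤ d * ((Real.log d - 3 * Real.log L + 25) * (N / d)) := by gcongr; linarith
          _ ≤ d * m := by gcongr
      have he := Real.exp_pos (-(d / N * ((1 - 2 * (1 / 20)) * d *
        min (((1 - 2 * (3 / L)) * d) ^ j) (N / (20 * d) - 1))))
      generalize Real.exp (-(d / N * ((1 - 2 * (1 / 20)) * d *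
        min (((1 - 2 * (3 / L)) * d) ^ j) (N / (20 * d) - 1)))) = z at he
      calc N ^ 2 * z ≤ N * (d * m) * z := by
            rw [sq]; gcongr
        _ = _ := by ring
    have h7 : 7 / L = 1 / L + 2 / L + 2 / L + 1 / L + 1 / L := by ring
    rw [h7]
    exact add_le_add (add_le_add (add_le_add (add_le_add t1 t2) t3) t4) t5

theorem measureReal_not_copsWin_compl_le_of_log_lt {n : ℕ} (p : unitInterval) {L d : ℝ}
    {j : ℕ} (hn : (n : ℝ) = Real.exp L) (hL : 160 * Real.exp 58 ≤ L) (hd : d = p * n) (hd0 : 0 < d)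
    (hC : 3 * Real.log L < Real.log d) (hdi : d ^ (j + 1) ≤ n * L) (hdN40 : 40 * d ≤ n)
    (hpL : 16 < p * L) :
    (binomialRandom (Fin n) p).real {G | ∀ k : ℕ,
      (k : ℝ) < (Real.log d - 3 * Real.log L) * (n / d ^ (j + 1)) → ¬ CopsWin G k}ᶜ ≤ 7 / L := by
  obtain ⟨hL1, hlogd, hdL⟩ := log_facts hL hd0 hC
  have hL0 : 0 < L := by linarith
  obtain ⟨hL12, hL2, hdL1⟩ := pow_three_facts hL1 hdL
  obtain ⟨N, hN⟩ : ∃ N : ℝ, N = n := ⟨_, rfl⟩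
  have hcard : ((Fintype.card (Fin n) : ℕ) : ℝ) = N := by rw [Fintype.card_fin, hN]
  rw [← hN] at hn hd hdi hdN40 ⊢
  have hn0 : 0 < N := hn ▸ Real.exp_pos L
  have hexpC := exp_neg_log_sub hL0 hd0
  have hC0 := sub_pos.2 hC
  have hCL : Real.log d - 3 * Real.log L ≤ L := by
    have h1 : 0 ≤ Real.log L := Real.log_nonneg (by linarith)
    have h2 := Real.log_le_log hd0 (show d ≤ N by linarith)
    rw [hn, Real.log_exp] at h2
    linarith
  generalize Real.log d - 3 * Real.log L = C at hexpC hC0 hCL ⊢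
  have hpd : (p : ℝ) = d / N := by rw [hd]; field_simp
  have hdN : 16 * N < d * L := by
    rw [hpd, div_mul_eq_mul_div, lt_div_iff₀ hn0] at hpL
    exact hpL
  -- Otherwise d² ≤ NL, and with dL > 16N this gives 256N ≤ L³ < d, contradicting d ≤ N.
  have hj : j = 0 := by
    by_contra hj
    have h1 : d ^ 2 ≤ d ^ (j + 1) := pow_le_pow_right₀ (by linarith) (by omega)
    have h2 : (d * L) ^ 2 ≤ N * L ^ 3 := by
      calc (d * L) ^ 2 = d ^ 2 * L ^ 2 := by ring
        _ ≤ N * L * L ^ 2 := by gcongr; linarith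
        _ = _ := by ring
    have h3 : (16 * N) ^ 2 ≤ (d * L) ^ 2 := by gcongr
    have h4 : N * (256 * N) ≤ N * L ^ 3 := by linarith
    have h5 := le_of_mul_le_mul_left h4 hn0
    linarith
  subst hj
  rw [zero_add, pow_one] at *
  have hNd : N / d ≤ L / 16 := by
    rw [div_le_div_iff₀ hd0 (by norm_num)]; linarith
  obtain ⟨K, hK⟩ : ∃ K, K = ⌊C * (N / d)⌋₊ := ⟨_, rfl⟩
  have hK1 : (K : ℝ) ≤ C * (N / d) := hK ▸ Nat.floor_le (by positivity)
  have hK2 : (K : ℝ) ≤ L ^ 2 / 16 := by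
    calc (K : ℝ) ≤ L * (L / 16) := hK1.trans (by gcongr)
      _ = _ := by ring
  have hrC : d / 2 * Real.exp (-C) = L ^ 3 / 2 := by
    rw [hexpC]; field_simp
  have key := measureReal_not_copsWin_compl_le_of_dense (V := Fin n) p
    (by rw [hpd, div_le_iff₀ hn0]; linarith) (δ := 1 / 20) (M := N / (20 * d)) (C := C)
    (r₀ := d / 2) (c := (1 - 2 * (1 / 20)) * d) (K := K) (by norm_num) (by norm_num)
    (by rw [hpd]; field_simp; norm_num)
    (by
      rw [hcard, div_le_iff₀ (by positivity)]
      nlinarith [mul_le_mul_of_nonneg_left (show 1 ≤ d by linarith) hn0.le])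
    (by rw [le_div_iff₀ (by positivity)]; linarith) (by rw [hcard, hd])
    (by
      calc (p : ℝ) * K ≤ d / N * (C * (N / d)) := by rw [hpd]; gcongr
        _ = C := by field_simp)
    (by rw [hrC]; linarith) (by linarith) (by linarith)
    (by
      rw [Fintype.card_fin]
      have : (K : ℝ) ≤ n := by rw [← hN]; linarith
      exact_mod_cast this)
    (by
      rw [Fintype.card_fin]
      have : ((2 : ℕ) : ℝ) ≤ n := by push_cast; rw [← hN]; linarith
      exact_mod_cast this)
  rw [hcard, ← hd, hrC] at key
  refine (measureReal_mono ?_ (measure_ne_top _ _)).trans (key.trans ?_)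
  · exact Set.compl_subset_compl.2 fun G hG k hk => hG k (hK ▸ Nat.le_floor hk.le)
  · have hexp1 := Real.exp_neg_le_one_div hL0
    have t1 : Real.exp (N * Real.exp (-((1 / 20) ^ 2 * d / 4))) - 1 ≤ 2 / L := by
      rw [hn]; exact exp_expands_bound_le hL0 (le_degree_exponents hL1 hdL).2.2
    -- The collision exponent L³/8 exceeds KL ≤ L³/16 by far more than the remaining O(L).
    have t2 : N ^ (K + 1) * (Real.exp 1 * √N * Real.exp (-(L ^ 3 / 2 / 4))) ≤ 1 / L := by
      refine le_trans ?_ hexp1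
      have hsqrt : √N ≤ N := by
        rw [Real.sqrt_le_left hn0.le]
        nlinarith
      calc N ^ (K + 1) * (Real.exp 1 * √N * Real.exp (-(L ^ 3 / 2 / 4)))
          ≤ N ^ (K + 1) * (Real.exp 1 * N * Real.exp (-(L ^ 3 / 2 / 4))) := by gcongr
        _ = Real.exp ((K + 1) * L + (1 + L + -(L ^ 3 / 2 / 4))) := by
            rw [hn, ← Real.exp_nat_mul, ← Real.exp_add, ← Real.exp_add, ← Real.exp_add]
            push_cast
            rfl
        _ ≤ _ := by
            apply Real.exp_le_exp.2
            have : K * L ≤ L ^ 3 / 16 := by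
              calc K * L ≤ L ^ 2 / 16 * L := by gcongr
                _ = _ := by ring
            linarith
    have t3 : N ^ 2 * Real.exp (-(p * ((1 - 2 * (1 / 20)) * d))) ≤ 1 / L := by
      refine le_trans ?_ hexp1
      rw [hn, ← Real.exp_nat_mul, ← Real.exp_add]
      apply Real.exp_le_exp.2
      have : 16 * L ^ 2 ≤ p * d := by
        have h1 : p * L ^ 3 ≤ p * d := mul_le_mul_of_nonneg_left hdL.le p.2.1
        have h2 : p * L ^ 3 = (p * L) * L ^ 2 := by ring
        nlinarith [sq_nonneg L]
      push_cast
      linarith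
    refine (add_le_add (add_le_add t1 t2) t3).trans ?_
    rw [← add_div, ← add_div]
    gcongr
    norm_num

end SimpleGraph

/-! ### The bound for fixed n, and the limit -/

namespace SimpleGraph

theorem measureReal_le_localizationNumber {n i : ℕ} (p : unitInterval) {L d : ℝ}
    (hn : (n : ℝ) = Real.exp L) (hL : 160 * Real.exp 58 ≤ L) (hd : d = p * n)
    (hdi : d ^ i ≤ n * L) (hdj : 2 * L ≤ d ^ (i + 1) / n) (hdN40 : 40 * d ≤ n) :
    1 - 7 / L ≤ (binomialRandom (Fin n) p).real {G |
      (Real.log d - 3 * Real.log L) * (n / d ^ i) ≤ (localizationNumber G : ℝ)} := by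
  have hL0 : 1 ≤ L := by linarith [Real.add_one_le_exp (58 : ℝ)]
  have hn0 : (0 : ℝ) < n := hn ▸ Real.exp_pos L
  have hd0 : 0 ≤ d := hd ▸ mul_nonneg p.2.1 hn0.le
  rcases le_or_gt (Real.log d) (3 * Real.log L) with hC | hC
  · have : {G : SimpleGraph (Fin n) | (Real.log d - 3 * Real.log L) * (n / d ^ i) ≤
        (localizationNumber G : ℝ)} = Set.univ := by
      refine Set.eq_univ_of_forall fun G => ?_
      have : (Real.log d - 3 * Real.log L) * (n / d ^ i) ≤ 0 :=
        mul_nonpos_of_nonpos_of_nonneg (by linarith) (by positivity)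
      exact this.trans (Nat.cast_nonneg _)
    rw [this, probReal_univ]
    have : 0 ≤ 7 / L := by positivity
    linarith
  have hdpos : 0 < d := hd0.lt_of_ne fun h => by
    rw [← h, Real.log_zero] at hC
    linarith [Real.log_nonneg hL0]
  -- For i = 0 the assumption would give d ≥ 2Ln, contrary to 40d ≤ n.
  obtain ⟨j, rfl⟩ : ∃ j, i = j + 1 := by
    refine ⟨i - 1, ?_⟩
    by_contra hi
    obtain rfl : i = 0 := by omega
    rw [zero_add, pow_one, le_div_iff₀ hn0] at hdj
    nlinarith
  have hbound : (binomialRandom (Fin n) p).real {G | ∀ k : ℕ,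
      (k : ℝ) < (Real.log d - 3 * Real.log L) * (n / d ^ (j + 1)) → ¬ CopsWin G k}ᶜ ≤ 7 / L := by
    rcases le_or_gt ((p : ℝ) * L) 16 with hpL | hpL
    · exact measureReal_not_copsWin_compl_le_of_sparse p hn hL hd hdpos hC hdi hdj hdN40 hpL
    · exact measureReal_not_copsWin_compl_le_of_log_lt p hn hL hd hdpos hC hdi hdN40 hpL
  rw [probReal_compl_eq_one_sub MeasurableSet.of_discrete] at hbound
  have hne : Nonempty (Fin n) := ⟨⟨0, by exact_mod_cast hn0⟩⟩
  refine le_trans (by linarith) (measureReal_mono (fun G hG => ?_) (measure_ne_top _ _))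
  exact lt_localizationNumber G fun k _ hk => hG k hk

end SimpleGraph

theorem theorem5p1 (p : ℕ → unitInterval) (d : ℕ → ℝ) (i : ℕ → ℕ)
    (hd : ∀ n, d n = (p n : ℝ) * (n : ℝ))
    -- `log n ≪ d ≪ n`
    (hlog : (fun n : ℕ => Real.log n) =o[atTop] d)
    (hlin : d =o[atTop] (fun n : ℕ => (n : ℝ)))
    -- `i = i(n)` is the largest integer such that `d ^ i ≪ n log log n`
    (hi : (fun n : ℕ => d n ^ i n) =o[atTop] (fun n : ℕ => (n : ℝ) * Real.log (Real.log n)))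
    (hmax : ∀ j : ℕ → ℕ,
      (fun n : ℕ => d n ^ j n) =o[atTop] (fun n : ℕ => (n : ℝ) * Real.log (Real.log n)) →
        ∀ᶠ n in atTop, j n ≤ i n)
    (hdiam : Tendsto (fun n : ℕ => d n ^ (i n + 1) / (n : ℝ) - 2 * Real.log n) atTop atTop) :
    Tendsto (fun n : ℕ => SimpleGraph.binomialRandom (Fin n) (p n)
      {G : SimpleGraph (Fin n) |
        (Real.log (d n) - 3 * Real.log (Real.log n)) * ((n : ℝ) / d n ^ i n)
          ≤ (localizationNumber G : ℝ)})
      atTop (𝓝 1) := by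
  have hlogn : Tendsto (fun n : ℕ => Real.log n) atTop atTop :=
    Real.tendsto_log_atTop.comp tendsto_natCast_atTop_atTop
  rw [← ENNReal.tendsto_toReal_iff (fun n => MeasureTheory.measure_ne_top _ _) ENNReal.one_ne_top,
    ENNReal.toReal_one]
  have hlower : Tendsto (fun n : ℕ => 1 - 7 / Real.log n) atTop (𝓝 1) := by
    simpa using (tendsto_const_nhds (x := (1 : ℝ))).sub (hlogn.const_div_atTop 7)
  refine tendsto_of_tendsto_of_tendsto_of_le_of_le' hlower tendsto_const_nhds ?_
    (Eventually.of_forall fun n => MeasureTheory.measureReal_le_one)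
  filter_upwards [hlogn.eventually_ge_atTop (160 * Real.exp 58), eventually_gt_atTop 0,
    hlin.def (show (0 : ℝ) < 1 / 40 by norm_num), hi.def one_pos,
    hdiam.eventually_ge_atTop 0] with n hL hn hdn hdi hdj
  have hn0 : (0 : ℝ) < n := by exact_mod_cast hn
  have hL1 : 1 ≤ Real.log n := by linarith [Real.add_one_le_exp (58 : ℝ)]
  refine SimpleGraph.measureReal_le_localizationNumber (p n) (Real.exp_log hn0).symm hL (hd n)
    ?_ (by linarith) ?_
  · rw [one_mul] at hdi
    refine (le_abs_self _).trans (hdi.trans ?_)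
    have h0 : 0 ≤ Real.log (Real.log n) := Real.log_nonneg hL1
    rw [Real.norm_of_nonneg (by positivity)]
    gcongr
    -- The weaker bound d^i ≤ n log n suffices, through log log n ≤ log n.
    exact Real.log_le_self (by linarith)
  · have := (le_abs_self (d n)).trans hdn
    rw [Real.norm_of_nonneg hn0.le] at this
    linarith
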